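/- Let $p,q\ge 1$ be integers, let $d=p+q$, let $\tau>0$, and let $\mathcal M\subset M_d(\mathbb R)$ be compact. Write each $M\in\mathcal M$ in blocks $M=\begin{pmatrix}A&B\\C&D\end{pmatrix}$ with $A\in M_p(\mathbb R)$ and $D\in M_q(\mathbb R)$, and suppose that for every $M\in\mathcal M$ the block $D$ is Hurwitz (all its eigenvalues have negative real part). Let $\mathcal S_{\mathcal M,\tau}$ be the set of right-continuous piecewise-constant signals $M:[0,\infty)\to\mathcal M$ with dwell time $\tau$: there are finitely (possibly zero) or infinitely many switching times $0=t_0<t_1<t_2<\cdots$, without finite accumulation point, such that $t_{k+1}\ge t_k+\tau$ for all $k\ge 0$ and $M$ is constant, with blocks $A_k,B_k,C_k,D_k$, on each interval $[t_k,t_{k+1})$ (the last of which is unbounded if there are finitely many switching times). For $\varepsilon>0$ consider the switched system $$\Upsilon^\varepsilon_\tau:\quad \dot x(t)=A_kx(t)+B_ky(t),\qquad \varepsilon\dot y(t)=C_kx(t)+D_ky(t),\qquad t\in[t_k,t_{k+1}),$$ with state $(x,y)\in\mathbb R^p\times\mathbb R^q$, and the reduced system $$\bar\Upsilon_\tau:\quad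 \dot{\bar x}(t)=(A_k-B_kD_k^{-1}C_k)\,\bar x(t),\qquad t\in[t_k,t_{k+1}),$$ with state $\bar x\in\mathbb R^p$, where in both systems the signal ranges over $\mathcal S_{\mathcal M,\tau}$ and the trajectories are continuous. For either system $\Upsilon$, let $\Phi_M(t,0)$ denote its flow from time $0$ to time $t$ along the signal $M$, let $|\cdot|$ be the Euclidean norm and $\|\cdot\|$ the induced operator norm. The maximal Lyapunov exponent is $$\lambda(\Upsilon)=\limsup_{t\to+\infty}\ \sup_{M\in\mathcal S_{\mathcal M,\tau}}\frac{\log\|\Phi_M(t,0)\|}{t}\qquad(\log 0=-\infty).$$ The system $\Upsilon$ is exponentially stable (ES) if there are $c,\delta>0$ such that $\|\Phi_M(t,0)\|\le ce^{-\delta t}$ for all $t\ge0$ and all $M\in\mathcal S_{\mathcal M,\tau}$; it is exponentially unstable (EU) if there are $c,\delta>0$, a signal $M\in\mathcal S_{\mathcal M,\tau}$ and a state $x_0\neq0$ such that $|\Phi_M(t,0)x_0|\ge ce^{\delta t}|x_0|$ for all $t\ge0$. Then $$\lim_{\varepsilon\searrow0}\lambda(\Upsilon^\varepsilon_\tau)=\lambda(\bar\Upsilon_\tau).$$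 In particular, if $\bar\Upsilon_\tau$ is ES (respectively, EU), then $\Upsilon^\varepsilon_\tau$ is ES (respectively, EU) for every $\varepsilon>0$ small enough. -/

import Mathlib

open Set Filter Topology

/-- A square real matrix is Hurwitz if all its complex eigenvalues have negative real part. -/
def Matrix.IsHurwitz {ι : Type*} [Fintype ι] [DecidableEq ι] (D : Matrix ι ι ℝ) : Prop :=
  ∀ z ∈ spectrum ℂ (D.map (algebraMap ℝ ℂ)), z.re < 0

namespace SwitchedSystem

/-- `Z`, restricted to `[0, ∞)`, is a right-continuous piecewise-constant signal with values in the
set of modes `𝓜`, whose switching times are locally finite and have dwell time `τ`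
(the first one is at least `τ`, any two of them are at least `τ` apart).
The points `t k` need not be discontinuities of `Z`, so that signals with no or with finitely many
switchings are included: the sequence of their switching times is continued arbitrarily. -/
structure IsSignal {α : Type*} (𝓜 : Set α) (τ : ℝ) (Z : ℝ → α) : Prop where
  mem : ∀ s, 0 ≤ s → Z s ∈ 𝓜
  exists_times : ∃ t : ℕ → ℝ, t 0 = 0 ∧ StrictMono t ∧ (∀ k, t k + τ ≤ t (k + 1)) ∧
    Tendsto t atTop atTop ∧ ∀ k, ∀ s ∈ Ico (t k) (t (k + 1)), Z s = Z (t k)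

/-- The signals with values in `𝓜` and dwell time `τ`. -/
def Signal {α : Type*} (𝓜 : Set α) (τ : ℝ) : Type _ := {Z : ℝ → α // IsSignal 𝓜 τ Z}

section

variable {α : Type*} {ι : Type*} [Fintype ι] [DecidableEq ι]

/-- `X` is the solution on `[0, ∞)` of `X'(t) = F (Z t) X(t)`, `X(0) = x₀`: it is continuous and
satisfies the equation on each `[t k, t (k + 1))`, with the right derivative, which is the derivative
wherever `Z` does not switch. -/
structure IsSolution (F : α → Matrix ι ι ℝ) (Z : ℝ → α) (x₀ : EuclideanSpace ℝ ι)
    (X : ℝ → EuclideanSpace ℝ ι) : Prop where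
  init : X 0 = x₀
  cont : ContinuousOn X (Ici 0)
  deriv : ∀ s, 0 ≤ s →
    HasDerivWithinAt X (Matrix.toEuclideanCLM (𝕜 := ℝ) (F (Z s)) (X s)) (Ici s) s

theorem exists_flow {𝓜 : Set α} {τ : ℝ} (F : α → Matrix ι ι ℝ) {Z : ℝ → α}
    (hZ : IsSignal 𝓜 τ Z) :
    ∃ Φ : ℝ → EuclideanSpace ℝ ι →L[ℝ] EuclideanSpace ℝ ι,
      ∀ x₀, IsSolution F Z x₀ (fun s => Φ s x₀) := by
  obtain ⟨t, ht0, htm, -, htt, htc⟩ := hZ.exists_times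
  let G : ℕ → EuclideanSpace ℝ ι →L[ℝ] EuclideanSpace ℝ ι :=
    fun k => Matrix.toEuclideanCLM (𝕜 := ℝ) (F (Z (t k)))
  let K : ℕ → EuclideanSpace ℝ ι →L[ℝ] EuclideanSpace ℝ ι :=
    fun k => Nat.rec 1 (fun j P => NormedSpace.exp ((t (j + 1) - t j) • G j) * P) k
  have hK : ∀ k, K (k + 1) = NormedSpace.exp ((t (k + 1) - t k) • G k) * K k := fun _ => rfl
  have hex : ∀ s, 0 ≤ s → ∃ k, s ∈ Ico (t k) (t (k + 1)) := by
    intro s hs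
    obtain ⟨n, hn⟩ := (htt.eventually (eventually_gt_atTop s)).exists
    classical
    have hP : ∃ n, s < t n := ⟨n, hn⟩
    have h1 := Nat.find_spec hP
    have h0 : Nat.find hP ≠ 0 := by
      intro h
      rw [h, ht0] at h1
      linarith
    obtain ⟨k, hk⟩ := Nat.exists_eq_succ_of_ne_zero h0
    refine ⟨k, ?_, ?_⟩
    · have := Nat.find_min hP (m := k) (by omega)
      linarith
    · rw [hk] at h1
      exact h1
  have huniq : ∀ {s : ℝ} {j k : ℕ}, s ∈ Ico (t j) (t (j + 1)) → s ∈ Ico (t k) (t (k + 1)) →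
      j = k := by
    intro s j k hj hk
    have h1 : j < k + 1 := htm.lt_iff_lt.1 (hj.1.trans_lt hk.2)
    have h2 : k < j + 1 := htm.lt_iff_lt.1 (hk.1.trans_lt hj.2)
    omega
  classical
  let idx : ℝ → ℕ := fun s => if h : ∃ k, s ∈ Ico (t k) (t (k + 1)) then h.choose else 0
  have hidx : ∀ {s : ℝ} {k : ℕ}, s ∈ Ico (t k) (t (k + 1)) → idx s = k := by
    intro s k hk
    have h : ∃ k, s ∈ Ico (t k) (t (k + 1)) := ⟨k, hk⟩
    have : idx s = h.choose := dif_pos h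
    rw [this]
    exact huniq h.choose_spec hk
  let Ψ : ℕ → ℝ → EuclideanSpace ℝ ι →L[ℝ] EuclideanSpace ℝ ι :=
    fun k s => NormedSpace.exp ((s - t k) • G k) * K k
  let Φ : ℝ → EuclideanSpace ℝ ι →L[ℝ] EuclideanSpace ℝ ι := fun s => Ψ (idx s) s
  have hstart : ∀ k, Ψ k (t k) = K k := by
    intro k
    change NormedSpace.exp ((t k - t k) • G k) * K k = K k
    rw [sub_self, zero_smul ℝ (G k), NormedSpace.exp_zero, one_mul]
  have hΦ : ∀ k, ∀ s ∈ Icc (t k) (t (k + 1)), Φ s = Ψ k s := by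
    intro k s hs
    rcases hs.2.lt_or_eq with h | h
    · simp only [Φ, hidx ⟨hs.1, h⟩]
    · subst h
      have h1 : idx (t (k + 1)) = k + 1 := hidx ⟨le_rfl, htm (Nat.lt_succ_self _)⟩
      simp only [Φ, h1, hstart]
      rfl
  have hΨ : ∀ k s, HasDerivAt (Ψ k) (G k * Ψ k s) s := by
    intro k s
    have h1 := (hasDerivAt_exp_smul_const' (𝕂 := ℝ) (G k) (s - t k)).comp_sub_const s (t k)
    have h2 := h1.mul_const (K k)
    rw [mul_assoc] at h2
    exact h2
  have hcIcc : ∀ k, ContinuousOn Φ (Icc (t k) (t (k + 1))) := fun k =>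
    ContinuousOn.congr (f := Ψ k)
      (fun s _ => (hΨ k s).continuousAt.continuousWithinAt) (hΦ k)
  have hc0 : ∀ k, ContinuousOn Φ (Icc 0 (t k)) := by
    intro k
    induction k with
    | zero => rw [ht0, Icc_self]; exact continuousOn_singleton _ _
    | succ k ih =>
      have h0 : (0 : ℝ) ≤ t k := ht0 ▸ htm.monotone (Nat.zero_le k)
      rw [← Icc_union_Icc_eq_Icc h0 (htm.monotone (Nat.le_succ k))]
      exact ih.union_of_isClosed (hcIcc k) isClosed_Icc isClosed_Icc
  have hc : ContinuousOn Φ (Ici 0) := by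
    intro s hs
    obtain ⟨k, hk⟩ := hex s hs
    refine (hc0 (k + 1) s ⟨hs, hk.2.le⟩).mono_of_mem_nhdsWithin ?_
    rw [← Ici_inter_Iic]
    exact inter_mem self_mem_nhdsWithin (mem_nhdsWithin_of_mem_nhds (Iic_mem_nhds hk.2))
  refine ⟨Φ, fun x₀ => ⟨?_, ?_, ?_⟩⟩
  · have h1 := hΦ 0 0 ⟨ht0.le, ht0 ▸ htm.monotone (Nat.zero_le 1)⟩
    have h2 := hstart 0
    rw [ht0] at h2
    change Φ 0 x₀ = x₀
    rw [h1, h2]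
    rfl
  · exact hc.clm_apply continuousOn_const
  · intro s hs
    obtain ⟨k, hk⟩ := hex s hs
    have h1 : HasDerivWithinAt Φ (G k * Ψ k s) (Ici s) s := by
      refine (hΨ k s).hasDerivWithinAt.congr_of_eventuallyEq ?_ (hΦ k s ⟨hk.1, hk.2.le⟩)
      filter_upwards [Icc_mem_nhdsGE hk.2] with u hu
      exact hΦ k u ⟨hk.1.trans hu.1, hu.2⟩
    have h2 := h1.clm_apply (hasDerivWithinAt_const s (Ici s) x₀)
    rw [← hΦ k s ⟨hk.1, hk.2.le⟩] at h2
    simpa [G, htc k s hk] using h2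

/-- The flow from time `0` of the switched system `X' = F (Z t) X` along the signal `Z`:
for every `x₀`, `s ↦ flow F Z s x₀` is the solution starting at `x₀`. -/
noncomputable def flow {𝓜 : Set α} {τ : ℝ} (F : α → Matrix ι ι ℝ) (Z : Signal 𝓜 τ) :
    ℝ → EuclideanSpace ℝ ι →L[ℝ] EuclideanSpace ℝ ι :=
  (exists_flow F Z.2).choose

theorem flow_spec {𝓜 : Set α} {τ : ℝ} (F : α → Matrix ι ι ℝ) (Z : Signal 𝓜 τ)
    (x₀ : EuclideanSpace ℝ ι) : IsSolution F Z.1 x₀ (fun s => flow F Z s x₀) :=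
  (exists_flow F Z.2).choose_spec x₀

/-- The maximal Lyapunov exponent
`limsup_{s → ∞} sup_Z log ‖flow F Z s‖ / s`, with the convention `log 0 = -∞` and the operator norm
induced by the Euclidean norm. -/
noncomputable def lyapunovExponent (𝓜 : Set α) (τ : ℝ) (F : α → Matrix ι ι ℝ) : EReal :=
  limsup (fun s : ℝ => ⨆ Z : Signal 𝓜 τ, ENNReal.log ‖flow F Z s‖ₑ / (s : EReal)) atTop

/-- Exponential stability, uniformly over the signals. -/
def IsES (𝓜 : Set α) (τ : ℝ) (F : α → Matrix ι ι ℝ) : Prop :=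
  ∃ c > (0 : ℝ), ∃ δ > (0 : ℝ), ∀ Z : Signal 𝓜 τ, ∀ s, 0 ≤ s →
    ‖flow F Z s‖ ≤ c * Real.exp (-δ * s)

/-- Exponential instability: some trajectory of some signal grows exponentially. -/
def IsEU (𝓜 : Set α) (τ : ℝ) (F : α → Matrix ι ι ℝ) : Prop :=
  ∃ c > (0 : ℝ), ∃ δ > (0 : ℝ), ∃ Z : Signal 𝓜 τ, ∃ x₀ : EuclideanSpace ℝ ι, x₀ ≠ 0 ∧
    ∀ s, 0 ≤ s → c * Real.exp (δ * s) * ‖x₀‖ ≤ ‖flow F Z s x₀‖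

end

section

variable {p q : ℕ}

/-- For `M = [A, B; C, D]`, the matrix of the system `x' = A x + B y`, `ε y' = C x + D y`. -/
noncomputable def fullMatrix (ε : ℝ) (M : Matrix (Fin p ⊕ Fin q) (Fin p ⊕ Fin q) ℝ) :
    Matrix (Fin p ⊕ Fin q) (Fin p ⊕ Fin q) ℝ :=
  Matrix.fromBlocks M.toBlocks₁₁ M.toBlocks₁₂ (ε⁻¹ • M.toBlocks₂₁) (ε⁻¹ • M.toBlocks₂₂)

/-- For `M = [A, B; C, D]`, the matrix `A - B D⁻¹ C` of the reduced system. -/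
noncomputable def reducedMatrix (M : Matrix (Fin p ⊕ Fin q) (Fin p ⊕ Fin q) ℝ) :
    Matrix (Fin p) (Fin p) ℝ :=
  M.toBlocks₁₁ - M.toBlocks₁₂ * M.toBlocks₂₂⁻¹ * M.toBlocks₂₁

end

end SwitchedSystem

/-! Every signal can be cut into pieces of duration in `[τ, 2τ]` on which it is constant, so its
flow at the cutting times is a product of letters, one for each pair (duration, mode) in the compact
set `letters 𝓜 τ`. Lyapunov exponents thus become growth rates of products over a compact alphabet
(`flow_startTime`, `exists_norm_flow_le_of_norm_wordProd_le`).

Along a piece, the variable `z = y + D⁻¹ C x` decays at rate of order `1 / ε`, and a piece lasts at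
least `τ`. By Tikhonov's estimate, the flow over a piece therefore converges in operator norm,
uniformly over the alphabet, to `limitPiece`: project to `x`, follow the reduced flow, lift to the
slow graph `y = -D⁻¹ C x` (`tendstoUniformlyOn_pieceFlow`). Projecting after lifting is the
identity, so products of limit letters telescope and grow exactly like the reduced system.

It remains to see that the growth rate of products is continuous under uniform convergence of the
letters. Weighting a letter of duration `h` by `exp (-μ h)` reduces a rate `μ` in time to
boundedness of products. Upper semicontinuity is submultiplicativity
(`eventually_exists_norm_wordProd_le`). Lower semicontinuity holds although the limit letters are
singular; it rests on Bochi's inequality, whose constant depends only on the space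
(`exists_norm_wordProd_le_mul_exp`).

Finally, ES is equivalent to a negative exponent, and EU to a positive one. That a positive exponent
yields one single growing trajectory is a compactness argument on infinite words
(`isEU_of_lyapunovExponent_pos`). -/

/-- The product `G (a (n - 1)) * ⋯ * G (a 0)`. -/
def wordProd {β A : Type*} [Monoid A] (G : β → A) (a : ℕ → β) : ℕ → A
  | 0 => 1
  | n + 1 => G (a n) * wordProd G a n

/-! ### Bochi's inequality for products that preserve a compact neighbourhood of the origin. -/

section Bochi

open Module

/-- Auerbach's argument: maximise the absolute value of the determinant over families in `K`. By
Cramer's rule, replacing the `i`-th vector by `x` multiplies the determinant by the `i`-th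
coordinate of `x`, which maximality bounds by one. -/
theorem exists_basis_mem_abs_repr_le_one {E : Type*} [NormedAddCommGroup E] [NormedSpace ℝ E]
    [FiniteDimensional ℝ E] {K : Set E} (hK : IsCompact K) (h0 : K ∈ 𝓝 0) :
    ∃ v : Basis (Fin (finrank ℝ E)) ℝ E, (∀ i, v i ∈ K) ∧ ∀ x ∈ K, ∀ i, |v.repr x i| ≤ 1 := by
  classical
  set e := finBasis ℝ E
  have hcont : Continuous fun w : Fin (finrank ℝ E) → E => |e.det w| := by
    simp only [Basis.det_apply]
    refine (Continuous.matrix_det ?_).abs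
    refine continuous_matrix fun i j => ?_
    simp only [Basis.toMatrix_apply]
    exact (e.coord i).continuous_of_finiteDimensional.comp (continuous_apply j)
  have hKpi : IsCompact (Set.univ.pi fun _ : Fin (finrank ℝ E) => K) :=
    isCompact_univ_pi fun _ => hK
  obtain ⟨w, hwK, hw⟩ := hKpi.exists_isMaxOn
    ⟨fun _ => 0, fun _ _ => mem_of_mem_nhds h0⟩ hcont.continuousOn
  have hpos : e.det w ≠ 0 := by
    have h1 : ∀ᶠ c : ℝ in 𝓝 0, ∀ i, c • e i ∈ K := by
      refine eventually_all.2 fun i => ?_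
      have : Tendsto (fun c : ℝ => c • e i) (𝓝 0) (𝓝 0) := by
        have h : Continuous fun c : ℝ => c • e i := by fun_prop
        simpa using h.tendsto 0
      exact this h0
    obtain ⟨c, hc, hc0⟩ := ((h1.filter_mono nhdsWithin_le_nhds).and
      (self_mem_nhdsWithin : {(0 : ℝ)}ᶜ ∈ 𝓝[≠] 0)).exists
    have h2 : |e.det fun i => c • e i| ≤ |e.det w| := hw fun i _ => hc i
    have h3 : e.det (fun i => c • e i) = c ^ (finrank ℝ E) := by
      have := e.det.map_smul_univ (fun _ => c) e
      simpa [e.det_self] using this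
    intro h
    rw [h3, h, abs_zero] at h2
    exact (abs_pos.2 (pow_ne_zero _ hc0)).not_ge h2
  obtain ⟨hli, hsp⟩ := (Basis.is_basis_iff_det e).2 (isUnit_iff_ne_zero.2 hpos)
  set v : Basis (Fin (finrank ℝ E)) ℝ E := Basis.mk hli hsp.ge
  have hv : (v : Fin (finrank ℝ E) → E) = w := Basis.coe_mk _ _
  refine ⟨v, fun i => hv ▸ hwK i trivial, fun x hx i => ?_⟩
  have h1 : |e.det (Function.update w i x)| ≤ |e.det w| := hw fun j _ => by
    by_cases h : j = i
    · subst h; simpa using hx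
    · simpa [Function.update_of_ne h] using hwK j trivial
  have h2 : e.det (Function.update w i x) = e.det w * v.repr x i := by
    have h3 := e.det.eq_smul_basis_det v
    have h4 : v.det (Function.update w i x) = v.repr x i := by
      rw [← hv, Basis.det_apply, Basis.toMatrix_update, Basis.toMatrix_self,
        ← Matrix.cramer_apply, Matrix.cramer_one]
      rfl
    have h5 := congrArg (fun f => f (Function.update w i x)) h3
    simpa [hv, h4] using h5
  rw [h2, abs_mul] at h1
  exact le_of_mul_le_mul_left (by simpa using h1) (abs_pos.2 hpos)

variable {E : Type*} [NormedAddCommGroup E] [InnerProductSpace ℝ E] [FiniteDimensional ℝ E]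

/-- Let `S` send an Auerbach basis `u` of `K` to the standard basis. A map preserving `K` sends each
`u k` into `K`, where all coordinates are at most one, so its conjugate by `S` is bounded by `d ^
2`. The singular value decomposition of `S` transfers this to an orthonormal basis, the weights
being the singular values. -/
theorem exists_orthonormalBasis_weights {K : Set E} (hK : IsCompact K) (h0 : K ∈ 𝓝 0) :
    ∃ (v : OrthonormalBasis (Fin (finrank ℝ E)) ℝ E) (s : Fin (finrank ℝ E) → ℝ),
      (∀ i, 0 < s i) ∧ ∀ Q : E →L[ℝ] E, MapsTo Q K K →
        ∀ i j, s i * |inner ℝ (v i) (Q (v j))| ≤ (finrank ℝ E : ℝ) ^ 2 * s j := by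
  set d := finrank ℝ E with hd
  obtain ⟨u, huK, hu⟩ : ∃ u : Basis (Fin d) ℝ E, (∀ i, u i ∈ K) ∧ ∀ x ∈ K, ∀ i, |u.repr x i| ≤ 1 :=
    exists_basis_mem_abs_repr_le_one hK h0
  let S : E ≃ₗ[ℝ] EuclideanSpace ℝ (Fin d) :=
    u.equivFun.trans (WithLp.linearEquiv 2 ℝ (Fin d → ℝ)).symm
  have hS : ∀ x i, S x i = u.repr x i := fun x i => rfl
  have hSle : ∀ x, ‖S x‖ ≤ ∑ i, |u.repr x i| := by
    intro x
    have h : S x = ∑ i, S x i • EuclideanSpace.single i (1 : ℝ) := by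
      ext j
      simp [Finset.sum_apply, Pi.single_apply]
    rw [h]
    refine (norm_sum_le _ _).trans (Finset.sum_le_sum fun i _ => ?_)
    simp [norm_smul, hS]
  let T : E →ₗ[ℝ] E := LinearMap.adjoint S.toLinearMap ∘ₗ S.toLinearMap
  have hTi : ∀ x y, inner ℝ x (T y) = inner ℝ (S x) (S y) := fun x y =>
    LinearMap.adjoint_inner_right S.toLinearMap x (S y)
  have hT : T.IsSymmetric := fun x y => by
    rw [hTi, real_inner_comm, hTi, real_inner_comm]
  let v := hT.eigenvectorBasis rfl
  have hTv : ∀ i, T (v i) = hT.eigenvalues rfl i • v i := fun i =>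
    hT.apply_eigenvectorBasis rfl i
  have hpos : ∀ i, 0 < ‖S (v i)‖ := fun i => by
    rw [norm_pos_iff]
    exact fun h => v.orthonormal.ne_zero i (S.map_eq_zero_iff.1 h)
  -- The vectors `S (v i)` are orthogonal, because `v` diagonalises `S* S`; Cauchy–Schwarz then
  -- bounds each component of `S x`.
  have hcoef : ∀ x i, ‖S (v i)‖ * |inner ℝ (v i) x| ≤ ‖S x‖ := by
    intro x i
    have h1 : inner ℝ (S (v i)) (S x) = ‖S (v i)‖ ^ 2 * inner ℝ (v i) x := by
      rw [← real_inner_self_eq_norm_sq, ← hTi, ← hTi, ← hT, hTv, inner_smul_left, inner_smul_right]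
      simp
    have h2 := abs_real_inner_le_norm (S (v i)) (S x)
    rw [h1, abs_mul, abs_of_nonneg (sq_nonneg _), pow_two, mul_assoc] at h2
    exact le_of_mul_le_mul_left h2 (hpos i)
  refine ⟨v, fun i => ‖S (v i)‖, hpos, fun Q hQ i j => (hcoef _ i).trans ?_⟩
  have h1 : S (Q (v j)) = ∑ k, u.repr (v j) k • S (Q (u k)) := by
    conv_lhs => rw [← u.sum_repr (v j)]
    simp only [map_sum, map_smul]
  have h2 : ∀ k, |u.repr (v j) k| ≤ ‖S (v j)‖ := fun k => by
    have := PiLp.norm_apply_le (S (v j)) k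
    rwa [hS, Real.norm_eq_abs] at this
  rw [h1]
  calc ‖∑ k, u.repr (v j) k • S (Q (u k))‖ ≤ ∑ k : Fin d, ‖S (v j)‖ * d := by
        refine (norm_sum_le _ _).trans (Finset.sum_le_sum fun k _ => ?_)
        rw [norm_smul]
        refine mul_le_mul (h2 k) ((hSle _).trans ?_) (norm_nonneg _) (norm_nonneg _)
        calc _ ≤ ∑ i : Fin d, (1 : ℝ) :=
              Finset.sum_le_sum fun i _ => hu _ (hQ (huK k)) i
          _ = d := by simp
    _ = (d : ℝ) ^ 2 * ‖S (v j)‖ := by simp; ring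

theorem norm_wordProd_le {A : Type*} [NormedRing A] [NormOneClass A] {β : Type*} {G : β → A}
    {a : ℕ → β} {b : ℝ} (h : ∀ i, ‖G (a i)‖ ≤ b) (n : ℕ) : ‖wordProd G a n‖ ≤ b ^ n := by
  have hb : 0 ≤ b := (norm_nonneg _).trans (h 0)
  induction n with
  | zero => simp [wordProd]
  | succ n ih =>
    rw [wordProd, pow_succ']
    exact (norm_mul_le _ _).trans (mul_le_mul (h n) ih (norm_nonneg _) hb)

/-- Bochi's inequality: if the factors leave a compact neighbourhood of the origin invariant, then
the norm of a product of `dim E` factors is controlled by one power less of the norms of the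
factors, uniformly in the neighbourhood. -/
theorem exists_norm_wordProd_finrank_le (E : Type*) [NormedAddCommGroup E] [InnerProductSpace ℝ E]
    [FiniteDimensional ℝ E] [Nontrivial E] :
    ∃ C : ℝ, 0 ≤ C ∧ ∀ (K : Set E), IsCompact K → K ∈ 𝓝 0 → ∀ (b : ℝ) {β : Type*}
      (G : β → E →L[ℝ] E) (a : ℕ → β), (∀ i, MapsTo (G (a i)) K K) → (∀ i, ‖G (a i)‖ ≤ b) →
      ‖wordProd G a (finrank ℝ E)‖ ≤ C * b ^ (finrank ℝ E - 1) := by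
  set d := finrank ℝ E with hd
  let c : ℕ → ℝ := fun n => Nat.rec 0 (fun _ r => d * ((d : ℝ) ^ 2 + r)) n
  have hc : ∀ n, c (n + 1) = d * ((d : ℝ) ^ 2 + c n) := fun _ => rfl
  have hc0 : ∀ n, 0 ≤ c n := by
    intro n
    induction n with
    | zero => exact le_rfl
    | succ n ih => rw [hc]; positivity
  refine ⟨(d : ℝ) ^ 2 * c d, mul_nonneg (by positivity) (hc0 d), ?_⟩
  intro K hK h0 b β G a hGK hGb
  have hb : 0 ≤ b := (norm_nonneg _).trans (hGb 0)
  obtain ⟨v, s, hs, hvs⟩ := exists_orthonormalBasis_weights hK h0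
  -- The rank counts the strictly larger weights, so it is less than `d` and drops when passing to a
  -- larger weight.
  let rk : Fin d → ℕ := fun i => (Finset.univ.filter fun k => s i < s k).card
  have hrk : ∀ i, rk i < d := fun i => by
    have : rk i < (Finset.univ : Finset (Fin d)).card :=
      Finset.card_lt_card (Finset.filter_ssubset.2 ⟨i, Finset.mem_univ _, lt_irrefl _⟩)
    simpa using this
  have hrk_lt : ∀ i k, s i < s k → rk k < rk i := fun i k h => by
    refine Finset.card_lt_card ((Finset.ssubset_iff_of_subset ?_).2 ⟨k, ?_, ?_⟩)
    · intro l hl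
      simp only [Finset.mem_filter, Finset.mem_univ, true_and] at hl ⊢
      exact h.trans hl
    · simpa using h
    · simp
  have hexp : ∀ (Q R : E →L[ℝ] E) i j, inner ℝ (v i) ((Q * R) (v j)) =
      ∑ k, inner ℝ (v i) (Q (v k)) * inner ℝ (v k) (R (v j)) := by
    intro Q R i j
    have h : R (v j) = ∑ k, inner ℝ (v k) (R (v j)) • v k := (v.sum_repr' _).symm
    rw [mul_apply_eq_comp]
    conv_lhs => rw [h]
    simp only [map_sum, map_smul, inner_sum, inner_smul_right]
    exact Finset.sum_congr rfl fun k _ => mul_comm _ _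
  have hent : ∀ (Q : E →L[ℝ] E) i j, |inner ℝ (v i) (Q (v j))| ≤ ‖Q‖ := by
    intro Q i j
    refine (abs_real_inner_le_norm _ _).trans ?_
    rw [v.orthonormal.1 i, one_mul]
    simpa [v.orthonormal.1 j] using Q.le_opNorm (v j)
  -- One power of `b` is saved in the rows of rank less than `n`. In the sum over `k`, if `s k ≤ s
  -- i` the weighted bound controls the entry of the new factor by `d ^ 2` without `b`; otherwise
  -- `k` has smaller rank and the saving comes from the induction hypothesis.
  have key : ∀ n i j, rk i < n →
      |inner ℝ (v i) (wordProd G a n (v j))| ≤ c n * b ^ (n - 1) := by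
    intro n
    induction n with
    | zero => intro i j h; omega
    | succ n ih =>
      intro i j hi
      rw [wordProd, hexp, hc, Nat.add_sub_cancel]
      calc |∑ k, inner ℝ (v i) (G (a n) (v k)) * inner ℝ (v k) (wordProd G a n (v j))|
          ≤ ∑ k : Fin d, ((d : ℝ) ^ 2 + c n) * b ^ n := by
            refine (Finset.abs_sum_le_sum_abs _ _).trans (Finset.sum_le_sum fun k _ => ?_)
            rw [abs_mul]
            rcases le_or_gt (s k) (s i) with hk | hk
            · have h1 : |inner ℝ (v i) (G (a n) (v k))| ≤ (d : ℝ) ^ 2 := by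
                refine le_of_mul_le_mul_left ((hvs _ (hGK n) i k).trans ?_) (hs i)
                rw [mul_comm]
                exact mul_le_mul_of_nonneg_right hk (by positivity)
              have h2 := (hent (wordProd G a n) k j).trans (norm_wordProd_le hGb n)
              calc _ ≤ (d : ℝ) ^ 2 * b ^ n := mul_le_mul h1 h2 (abs_nonneg _) (by positivity)
                _ ≤ _ := mul_le_mul_of_nonneg_right (le_add_of_nonneg_right (hc0 n)) (by positivity)
            · have h3 : rk k < n := by have := hrk_lt i k hk; omega
              have h1 := (hent (G (a n)) i k).trans (hGb n)
              calc _ ≤ b * (c n * b ^ (n - 1)) := mul_le_mul h1 (ih k j h3) (abs_nonneg _) hb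
                _ = c n * b ^ n := by
                  rw [← Nat.sub_add_cancel (show 1 ≤ n by omega), Nat.add_sub_cancel, pow_succ]
                  ring
                _ ≤ _ := mul_le_mul_of_nonneg_right
                  (le_add_of_nonneg_left (by positivity)) (by positivity)
        _ = _ := by simp; ring
  refine ContinuousLinearMap.opNorm_le_bound _ (mul_nonneg (mul_nonneg (by positivity) (hc0 d))
    (pow_nonneg hb _)) fun x => ?_
  set P := wordProd G a d
  have hx : P x = ∑ i, ∑ j, (inner ℝ (v j) x * inner ℝ (v i) (P (v j))) • v i := by
    conv_lhs => rw [← v.sum_repr' (P x), ← v.sum_repr' x]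
    simp only [map_sum, map_smul, inner_sum, inner_smul_right, Finset.sum_smul]
  rw [hx]
  calc ‖∑ i, ∑ j, (inner ℝ (v j) x * inner ℝ (v i) (P (v j))) • v i‖
      ≤ ∑ i : Fin d, ∑ j : Fin d, ‖x‖ * (c d * b ^ (d - 1)) := by
        refine (norm_sum_le _ _).trans (Finset.sum_le_sum fun i _ => ?_)
        refine (norm_sum_le _ _).trans (Finset.sum_le_sum fun j _ => ?_)
        rw [norm_smul, v.orthonormal.1 i, mul_one, Real.norm_eq_abs, abs_mul]
        refine mul_le_mul ?_ (key d i j (hrk i)) (abs_nonneg _) (norm_nonneg _)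
        simpa [v.orthonormal.1 j] using abs_real_inner_le_norm (v j) x
    _ = _ := by simp; ring

end Bochi

/-! ### Concatenation of words and growth of submultiplicative sequences. -/

section WordProd

variable {β A : Type*} [Monoid A]

theorem wordProd_add (G : β → A) (a : ℕ → β) (m n : ℕ) :
    wordProd G a (m + n) = wordProd G (fun i => a (m + i)) n * wordProd G a m := by
  induction n with
  | zero => simp [wordProd]
  | succ n ih => rw [← add_assoc, wordProd, ih, wordProd, mul_assoc]

theorem wordProd_cons (G : β → A) (c : β) (a : ℕ → β) (n : ℕ) :
    wordProd G (fun i => Nat.casesOn i c a) (n + 1) = wordProd G a n * G c := by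
  rw [add_comm, wordProd_add]
  simp [wordProd, add_comm 1]

theorem wordProd_block (G : β → A) (a : ℕ → β) (n m : ℕ) :
    wordProd (fun c : ℕ → β => wordProd G c n) (fun k i => a (k * n + i)) m =
      wordProd G a (m * n) := by
  induction m with
  | zero => simp [wordProd]
  | succ m ih => rw [wordProd, ih, Nat.succ_mul, wordProd_add]

end WordProd

/-- By Fekete's lemma `log (A n) / n` has a limit `L`. Taking logarithms in `hC` and dividing by `n`
gives `d L ≤ (d - 1) L`, that is, `L ≤ 0`. -/
theorem exists_le_mul_exp_of_submultiplicative {A : ℕ → ℝ} (h1 : ∀ n, 1 ≤ A n)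
    (hm : ∀ m n, A (m + n) ≤ A m * A n) {d : ℕ} (hd : 0 < d) {C : ℝ}
    (hC : ∀ n, A (d * n) ≤ C * A n ^ (d - 1)) {η : ℝ} (hη : 0 < η) :
    ∃ B, ∀ n : ℕ, A n ≤ B * Real.exp (η * n) := by
  have hpos : ∀ n, 0 < A n := fun n => one_pos.trans_le (h1 n)
  have hsub : Subadditive fun n => Real.log (A n) := fun m n => by
    rw [← Real.log_mul (hpos m).ne' (hpos n).ne']
    exact Real.log_le_log (hpos _) (hm m n)
  have hbdd : BddBelow (range fun n : ℕ => Real.log (A n) / n) :=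
    ⟨0, by rintro _ ⟨n, rfl⟩; exact div_nonneg (Real.log_nonneg (h1 n)) n.cast_nonneg⟩
  have hlim := hsub.tendsto_lim hbdd
  set L := hsub.lim
  have hC0 : 0 < C := pos_of_mul_pos_left ((hpos _).trans_le (hC 0)) (by have := hpos 0; positivity)
  have hd' : (0 : ℝ) < d := by exact_mod_cast hd
  have hL : L ≤ 0 := by
    have h2 : Tendsto (fun n : ℕ => (d : ℝ) * (Real.log (A (d * n)) / ((d * n : ℕ) : ℝ))) atTop
        (𝓝 (d * L)) :=
      (hlim.comp (tendsto_id.const_mul_atTop' hd)).const_mul _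
    have h3 : Tendsto (fun n : ℕ => Real.log C / n + ((d : ℝ) - 1) * (Real.log (A n) / n)) atTop
        (𝓝 (0 + ((d : ℝ) - 1) * L)) :=
      (tendsto_const_div_atTop_nhds_zero_nat _).add (hlim.const_mul _)
    have h4 := le_of_tendsto_of_tendsto h2 h3 ?_
    · linarith
    · filter_upwards [eventually_gt_atTop 0] with n hn
      have hn' : (0 : ℝ) < n := by exact_mod_cast hn
      have h5 := Real.log_le_log (hpos _) (hC n)
      rw [Real.log_mul hC0.ne' (pow_pos (hpos n) _).ne', Real.log_pow, Nat.cast_sub hd,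
        Nat.cast_one] at h5
      push_cast
      rw [show (d : ℝ) * (Real.log (A (d * n)) / (d * n)) = Real.log (A (d * n)) / n by
        field_simp, mul_div_assoc', ← add_div]
      exact div_le_div_of_nonneg_right h5 hn'.le
  obtain ⟨N, hN⟩ := eventually_atTop.1 ((hlim.eventually_lt_const (hL.trans_lt hη)).and
    (eventually_gt_atTop 0))
  refine ⟨1 + ∑ i ∈ Finset.range N, A i, fun n => ?_⟩
  have hS : 0 ≤ ∑ i ∈ Finset.range N, A i := Finset.sum_nonneg fun i _ => (hpos i).le
  have hexp : 1 ≤ Real.exp (η * n) := Real.one_le_exp (by positivity)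
  rcases lt_or_ge n N with h | h
  · have h5 : A n ≤ ∑ i ∈ Finset.range N, A i :=
      Finset.single_le_sum (fun i _ => (hpos i).le) (Finset.mem_range.2 h)
    nlinarith
  · obtain ⟨h5, h6⟩ := hN n h
    have hn' : (0 : ℝ) < n := by exact_mod_cast h6
    rw [div_lt_iff₀ hn'] at h5
    have h7 : A n ≤ Real.exp (η * n) := by
      rw [← Real.exp_log (hpos n)]
      exact Real.exp_le_exp.2 h5.le
    nlinarith

/-! ### Semicontinuity of the joint spectral radius. -/

section Perturbation

open Module

theorem eventually_norm_wordProd_sub_le {A κ β : Type*} [NormedRing A] [NormOneClass A]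
    {l : Filter κ} {S : Set β} {G : κ → β → A} {G₀ : β → A} (hG : TendstoUniformlyOn G G₀ l S)
    {b : ℝ} (hb : ∀ x ∈ S, ‖G₀ x‖ ≤ b) (n : ℕ) {η : ℝ} (hη : 0 < η) :
    ∀ᶠ ε in l, ∀ a : ℕ → β, (∀ i, a i ∈ S) →
      ‖wordProd (G ε) a n - wordProd G₀ a n‖ ≤ η := by
  have hG' := Metric.tendstoUniformlyOn_iff.1 hG
  induction n generalizing η with
  | zero => exact Eventually.of_forall fun ε a _ => by simpa [wordProd] using hη.le
  | succ n ih =>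
    -- If `S` is empty, `b` may be negative.
    set b' := max b 0
    have hb0 : 0 ≤ b' := le_max_right _ _
    filter_upwards [hG' 1 one_pos, hG' (η / 2 / (b' ^ n + 1)) (by positivity),
      ih (η := η / 2 / (b' + 1)) (by positivity)] with ε h1 h2 h3 a ha
    have e : wordProd (G ε) a (n + 1) - wordProd G₀ a (n + 1) =
        G ε (a n) * (wordProd (G ε) a n - wordProd G₀ a n) +
          (G ε (a n) - G₀ (a n)) * wordProd G₀ a n := by
      simp only [wordProd]; noncomm_ring
    have h1' := h1 _ (ha n)
    have h2' := h2 _ (ha n)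
    rw [dist_comm, dist_eq_norm] at h1' h2'
    have h4 : ‖G ε (a n)‖ ≤ b' + 1 := by
      calc ‖G ε (a n)‖ = ‖G₀ (a n) + (G ε (a n) - G₀ (a n))‖ := by congr 1; abel
        _ ≤ _ := (norm_add_le _ _).trans
          (add_le_add ((hb _ (ha n)).trans (le_max_left _ _)) h1'.le)
    have h5 : ‖wordProd G₀ a n‖ ≤ b' ^ n + 1 :=
      (norm_wordProd_le (fun i => (hb _ (ha i)).trans (le_max_left _ _)) n).trans (by linarith)
    rw [e]
    calc _ ≤ (b' + 1) * (η / 2 / (b' + 1)) + η / 2 / (b' ^ n + 1) * (b' ^ n + 1) :=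
          (norm_add_le _ _).trans (add_le_add
            ((norm_mul_le _ _).trans (mul_le_mul h4 (h3 a ha) (norm_nonneg _) (by positivity)))
            ((norm_mul_le _ _).trans (mul_le_mul h2'.le h5 (norm_nonneg _) (by positivity))))
      _ = η := by field_simp; ring

/-- Upper semicontinuity of the joint spectral radius. -/
theorem eventually_exists_norm_wordProd_le {A κ β : Type*} [NormedRing A] [NormOneClass A]
    {l : Filter κ} {S : Set β} {G : κ → β → A} {G₀ : β → A} (hG : TendstoUniformlyOn G G₀ l S)
    {b : ℝ} (hb : ∀ x ∈ S, ‖G₀ x‖ ≤ b) {C θ : ℝ} (hθ0 : 0 ≤ θ) (hθ : θ < 1)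
    (h : ∀ a : ℕ → β, (∀ i, a i ∈ S) → ∀ n, ‖wordProd G₀ a n‖ ≤ C * θ ^ n) :
    ∀ᶠ ε in l, ∃ C', ∀ a : ℕ → β, (∀ i, a i ∈ S) → ∀ n, ‖wordProd (G ε) a n‖ ≤ C' := by
  -- Some length `n` makes all limit products smaller than `1 / 2`, hence all nearby products of
  -- that length at most one. Longer words are cut into such blocks and a remainder shorter than
  -- `n`.
  have hlim : Tendsto (fun n : ℕ => C * θ ^ n) atTop (𝓝 0) := by
    simpa using (tendsto_pow_atTop_nhds_zero_of_lt_one hθ0 hθ).const_mul C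
  obtain ⟨n, hn, hn0⟩ := ((hlim.eventually_lt_const (show (0 : ℝ) < 1 / 2 by norm_num)).and
    (eventually_gt_atTop 0)).exists
  filter_upwards [eventually_norm_wordProd_sub_le hG hb n (show (0 : ℝ) < 1 / 2 by norm_num),
    eventually_norm_wordProd_sub_le hG hb 1 one_pos] with ε h1 h2
  set b' := max b 0 + 1
  have hb1 : 1 ≤ b' := by simp [b']
  have hl : ∀ x ∈ S, ‖G ε x‖ ≤ b' := fun x hx => by
    have := h2 (fun _ => x) fun _ => hx
    simp only [wordProd, mul_one] at this
    calc ‖G ε x‖ = ‖G₀ x + (G ε x - G₀ x)‖ := by congr 1; abel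
      _ ≤ _ := (norm_add_le _ _).trans (add_le_add ((hb _ hx).trans (le_max_left _ _)) this)
  have hn1 : ∀ a : ℕ → β, (∀ i, a i ∈ S) → ‖wordProd (G ε) a n‖ ≤ 1 := fun a ha => by
    calc ‖wordProd (G ε) a n‖
        = ‖wordProd G₀ a n + (wordProd (G ε) a n - wordProd G₀ a n)‖ := by congr 1; abel
      _ ≤ 1 / 2 + 1 / 2 := (norm_add_le _ _).trans (add_le_add ((h a ha n).trans hn.le) (h1 a ha))
      _ = 1 := by norm_num
  refine ⟨b' ^ n, fun a ha m => ?_⟩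
  induction m using Nat.strong_induction_on generalizing a with
  | _ m ih =>
    rcases lt_or_ge m n with hmn | hmn
    · exact (norm_wordProd_le (fun i => hl _ (ha i)) m).trans (pow_le_pow_right₀ hb1 hmn.le)
    · obtain ⟨k, rfl⟩ := Nat.exists_eq_add_of_le hmn
      rw [wordProd_add]
      calc _ ≤ b' ^ n * 1 := (norm_mul_le _ _).trans (mul_le_mul
            (ih k (by omega) _ fun i => ha _) (hn1 a ha) (norm_nonneg _) (by positivity))
        _ = _ := mul_one _

variable {E : Type*} [NormedAddCommGroup E] [InnerProductSpace ℝ E] [FiniteDimensional ℝ E]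

/-- Bochi's inequality is applied to blocks of length `n`. The essential point is that `C₀` depends
only on `E`: the bound `C` on all products serves only to produce the invariant neighbourhood. -/
theorem exists_norm_wordProd_mul_le (E : Type*) [NormedAddCommGroup E] [InnerProductSpace ℝ E]
    [FiniteDimensional ℝ E] [Nontrivial E] :
    ∃ C₀ : ℝ, 0 ≤ C₀ ∧ ∀ {β : Type*} (S : Set β) (G : β → E →L[ℝ] E) (C : ℝ),
      (∀ a : ℕ → β, (∀ i, a i ∈ S) → ∀ n, ‖wordProd G a n‖ ≤ C) → ∀ (n : ℕ) (b : ℝ),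
      (∀ a : ℕ → β, (∀ i, a i ∈ S) → ‖wordProd G a n‖ ≤ b) →
      ∀ a : ℕ → β, (∀ i, a i ∈ S) →
        ‖wordProd G a (finrank ℝ E * n)‖ ≤ C₀ * b ^ (finrank ℝ E - 1) := by
  obtain ⟨C₀, hC₀, H⟩ := exists_norm_wordProd_finrank_le E
  refine ⟨C₀, hC₀, fun {β} S G C hC n b hb a ha => ?_⟩
  -- `K` collects the vectors whose images under all products stay in the unit ball. Prepending a
  -- letter to a word shows its invariance, and boundedness of the products makes it a neighbourhood
  -- of the origin.
  let K : Set E := Metric.closedBall 0 1 ∩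
    {x | ∀ a : ℕ → β, (∀ i, a i ∈ S) → ∀ n, ‖wordProd G a n x‖ ≤ 1}
  have hK : IsCompact K := by
    refine (isCompact_closedBall 0 1).inter_right ?_
    simp only [ofPred_forall]
    exact isClosed_iInter fun a => isClosed_iInter fun _ => isClosed_iInter fun m =>
      isClosed_le (by fun_prop) continuous_const
  have hK0 : K ∈ 𝓝 0 := by
    have hC' : 0 ≤ C := (norm_nonneg _).trans (hC a ha 0)
    refine mem_of_superset (Metric.ball_mem_nhds (0 : E) (show 0 < 1 / (C + 1) by positivity)) ?_
    intro x hx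
    rw [mem_ball_zero_iff, lt_div_iff₀ (by positivity)] at hx
    refine ⟨?_, fun c hc m => ?_⟩
    · rw [mem_closedBall_zero_iff]
      nlinarith [norm_nonneg x]
    · refine ((wordProd G c m).le_opNorm x).trans ?_
      nlinarith [norm_nonneg x, mul_le_mul_of_nonneg_right (hC c hc m) (norm_nonneg x)]
  have hinv : ∀ c ∈ S, MapsTo (G c) K K := by
    intro c hc x hx
    refine ⟨?_, fun w hw m => ?_⟩
    · have := hx.2 (fun _ => c) (fun _ => hc) 1
      simpa [wordProd] using this
    · have := hx.2 (fun i => Nat.casesOn i c w) (fun i => by cases i <;> simp [hc, hw]) (m + 1)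
      rwa [wordProd_cons] at this
  have hinvn : ∀ c : ℕ → β, (∀ i, c i ∈ S) → ∀ m, MapsTo (wordProd G c m : E →L[ℝ] E) K K := by
    intro c hc m
    induction m with
    | zero => exact fun x hx => hx
    | succ m ih => exact fun x hx => hinv _ (hc m) (ih hx)
  rw [← wordProd_block]
  exact H K hK hK0 b (fun c : ℕ → β => wordProd G c n) (fun k i => a (k * n + i))
    (fun k => hinvn _ (fun i => ha _) n) fun k => hb _ fun i => ha _

/-- Lower semicontinuity of the joint spectral radius. -/
theorem exists_norm_wordProd_le_mul_exp [Nontrivial E] {κ β : Type*} {l : Filter κ} {S : Set β}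
    {G : κ → β → E →L[ℝ] E} {G₀ : β → E →L[ℝ] E} (hG : TendstoUniformlyOn G G₀ l S)
    {b : ℝ} (hb : ∀ x ∈ S, ‖G₀ x‖ ≤ b)
    (hfreq : ∃ᶠ ε in l, ∃ C, ∀ a : ℕ → β, (∀ i, a i ∈ S) → ∀ n, ‖wordProd (G ε) a n‖ ≤ C)
    {η : ℝ} (hη : 0 < η) :
    ∃ B, ∀ a : ℕ → β, (∀ i, a i ∈ S) → ∀ n : ℕ, ‖wordProd G₀ a n‖ ≤ B * Real.exp (η * n) := by
  obtain ⟨C₀, hC₀, H⟩ := exists_norm_wordProd_mul_le E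
  set d := finrank ℝ E
  have hd : 0 < d := finrank_pos
  -- Inserting `1` gives `1 ≤ A n`, which makes the logarithms nonnegative and lets additive errors
  -- be absorbed into multiples of `A n`.
  let T : ℕ → Set ℝ := fun n => insert 1 {r | ∃ a : ℕ → β, (∀ i, a i ∈ S) ∧ r = ‖wordProd G₀ a n‖}
  have hT : ∀ n, BddAbove (T n) := fun n => by
    refine BddAbove.insert _ ⟨b ^ n, ?_⟩
    rintro _ ⟨a, ha, rfl⟩
    exact norm_wordProd_le (fun i => hb _ (ha i)) n
  let A : ℕ → ℝ := fun n => sSup (T n)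
  have h1 : ∀ n, 1 ≤ A n := fun n => le_csSup (hT n) (mem_insert _ _)
  have hA : ∀ n (a : ℕ → β), (∀ i, a i ∈ S) → ‖wordProd G₀ a n‖ ≤ A n := fun n a ha =>
    le_csSup (hT n) (mem_insert_of_mem _ ⟨a, ha, rfl⟩)
  have hAle : ∀ n r, 1 ≤ r → (∀ a : ℕ → β, (∀ i, a i ∈ S) → ‖wordProd G₀ a n‖ ≤ r) → A n ≤ r := by
    intro n r h1 h
    refine csSup_le ⟨1, mem_insert _ _⟩ ?_
    rintro _ (rfl | ⟨a, ha, rfl⟩)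
    exacts [h1, h a ha]
  have hm : ∀ m n, A (m + n) ≤ A m * A n := fun m n => by
    refine hAle _ _ (one_le_mul_of_one_le_of_one_le (h1 m) (h1 n)) fun a ha => ?_
    rw [wordProd_add, mul_comm (A m)]
    exact (norm_mul_le _ _).trans (mul_le_mul (hA _ _ fun i => ha _) (hA _ _ ha) (norm_nonneg _)
      (zero_le_one.trans (h1 n)))
  have hC : ∀ n, A (d * n) ≤ (1 + C₀ * 2 ^ (d - 1)) * A n ^ (d - 1) := fun n => by
    have hAp : 1 ≤ A n ^ (d - 1) := one_le_pow₀ (h1 n)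
    refine hAle _ _ (one_le_mul_of_one_le_of_one_le (by simp; positivity) hAp) fun a ha => ?_
    -- The choice of `ε` depends on `n`, and the bound `C` may blow up with it, but `C` does not
    -- enter the final estimate.
    obtain ⟨ε, ⟨C, hCε⟩, hε1, hε2⟩ := (hfreq.and_eventually
      ((eventually_norm_wordProd_sub_le hG hb n one_pos).and
        (eventually_norm_wordProd_sub_le hG hb (d * n) one_pos))).exists
    have h2 : ∀ c : ℕ → β, (∀ i, c i ∈ S) → ‖wordProd (G ε) c n‖ ≤ 2 * A n := fun c hc => by
      calc ‖wordProd (G ε) c n‖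
          = ‖wordProd G₀ c n + (wordProd (G ε) c n - wordProd G₀ c n)‖ := by congr 1; abel
        _ ≤ A n + 1 := (norm_add_le _ _).trans (add_le_add (hA n c hc) (hε1 c hc))
        _ ≤ 2 * A n := by linarith [h1 n]
    have h3 := H S (G ε) C hCε n _ h2 a ha
    calc ‖wordProd G₀ a (d * n)‖
        = ‖wordProd (G ε) a (d * n) - (wordProd (G ε) a (d * n) - wordProd G₀ a (d * n))‖ := by
          congr 1; abel
      _ ≤ C₀ * (2 * A n) ^ (d - 1) + 1 := (norm_sub_le _ _).trans (add_le_add h3 (hε2 a ha))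
      _ ≤ _ := by rw [mul_pow]; nlinarith
  obtain ⟨B, hB⟩ := exists_le_mul_exp_of_submultiplicative h1 hm hd hC hη
  exact ⟨B, fun a ha n => (hA n a ha).trans (hB n)⟩

end Perturbation

/-! ### Exponentials of bounded operators. -/

theorem norm_exp_smul_apply_le {E : Type*} [NormedAddCommGroup E] [NormedSpace ℝ E]
    [CompleteSpace E] (A : E →L[ℝ] E) {t : ℝ} (ht : 0 ≤ t) (x : E) :
    ‖NormedSpace.exp (t • A) x‖ ≤ Real.exp (‖A‖ * t) * ‖x‖ := by
  have hd : ∀ s, HasDerivAt (fun s : ℝ => NormedSpace.exp (s • A) x)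
      (A (NormedSpace.exp (s • A) x)) s := fun s => by
    simpa using (hasDerivAt_exp_smul_const' (𝕂 := ℝ) A s).clm_apply (hasDerivAt_const s x)
  have h := norm_le_gronwallBound_of_norm_deriv_right_le (a := 0) (b := t) (δ := ‖x‖) (K := ‖A‖)
    (ε := 0) (fun s _ => (hd s).continuousAt.continuousWithinAt)
    (fun s _ => (hd s).hasDerivWithinAt) (by simp [NormedSpace.exp_zero])
    (fun s _ => by simpa using A.le_opNorm _) t ⟨ht, le_rfl⟩
  rw [gronwallBound_ε0, sub_zero, mul_comm] at h
  exact h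

theorem norm_exp_smul_le {E : Type*} [NormedAddCommGroup E] [NormedSpace ℝ E]
    [CompleteSpace E] {A : E →L[ℝ] E} {K : ℝ} (hA : ‖A‖ ≤ K) {t : ℝ} (ht : 0 ≤ t) :
    ‖NormedSpace.exp (t • A)‖ ≤ Real.exp (K * t) :=
  ContinuousLinearMap.opNorm_le_bound _ (Real.exp_pos _).le fun x =>
    (norm_exp_smul_apply_le A ht x).trans (by gcongr)

theorem exp_zero_smul {E : Type*} [NormedAddCommGroup E] [NormedSpace ℝ E] [CompleteSpace E]
    (A : E →L[ℝ] E) : NormedSpace.exp ((0 : ℝ) • A) = 1 := by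
  rw [zero_smul ℝ A, NormedSpace.exp_zero]

theorem exp_add_smul {E : Type*} [NormedAddCommGroup E] [NormedSpace ℝ E] [CompleteSpace E]
    (A : E →L[ℝ] E) (s t : ℝ) :
    NormedSpace.exp ((s + t) • A) = NormedSpace.exp (s • A) * NormedSpace.exp (t • A) := by
  rw [add_smul]
  have : NormedAlgebra ℚ (E →L[ℝ] E) := .restrictScalars ℚ ℝ _
  exact NormedSpace.exp_add_of_commute (((Commute.refl A).smul_left s).smul_right t)

theorem continuous_exp_clm {E : Type*} [NormedAddCommGroup E] [NormedSpace ℝ E] [CompleteSpace E] :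
    Continuous (NormedSpace.exp : (E →L[ℝ] E) → E →L[ℝ] E) := by
  have : NormedAlgebra ℚ (E →L[ℝ] E) := .restrictScalars ℚ ℝ _
  exact NormedSpace.exp_continuous

theorem Matrix.continuous_toEuclideanCLM {ι : Type*} [Fintype ι] [DecidableEq ι] :
    Continuous (Matrix.toEuclideanCLM (𝕜 := ℝ) (n := ι)) :=
  LinearMap.continuous_of_finiteDimensional
    (Matrix.toEuclideanCLM (𝕜 := ℝ) (n := ι)).toAlgEquiv.toLinearMap

namespace SwitchedSystem

/-! ### Signals as words over the alphabet of durations and modes. -/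

section Words

variable {α : Type*} {𝓜 : Set α} {τ : ℝ}

/-- The durations and the modes of the pieces of a signal. -/
def letters (𝓜 : Set α) (τ : ℝ) : Set (ℝ × α) := Icc τ (2 * τ) ×ˢ 𝓜

/-- The time at which the `n`-th piece starts. -/
def startTime (a : ℕ → ℝ × α) (n : ℕ) : ℝ := ∑ i ∈ Finset.range n, (a i).1

@[simp] theorem startTime_zero (a : ℕ → ℝ × α) : startTime a 0 = 0 := by simp [startTime]

theorem startTime_succ (a : ℕ → ℝ × α) (n : ℕ) :
    startTime a (n + 1) = startTime a n + (a n).1 := Finset.sum_range_succ _ _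

theorem startTime_add (a : ℕ → ℝ × α) (m n : ℕ) :
    startTime a (m + n) = startTime a m + startTime (fun i => a (m + i)) n :=
  Finset.sum_range_add _ _ _

theorem mul_le_startTime {a : ℕ → ℝ × α} (ha : ∀ i, a i ∈ letters 𝓜 τ) (n : ℕ) :
    τ * n ≤ startTime a n := by
  induction n with
  | zero => simp
  | succ n ih =>
    rw [startTime_succ]
    push_cast
    linarith [(ha n).1.1]

theorem startTime_nonneg (hτ : 0 < τ) {a : ℕ → ℝ × α} (ha : ∀ i, a i ∈ letters 𝓜 τ) (n : ℕ) :
    0 ≤ startTime a n :=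
  le_trans (by positivity) (mul_le_startTime ha n)

theorem strictMono_startTime (hτ : 0 < τ) {a : ℕ → ℝ × α} (ha : ∀ i, a i ∈ letters 𝓜 τ) :
    StrictMono (startTime a) :=
  strictMono_nat_of_lt_succ fun n => by
    rw [startTime_succ]
    linarith [(ha n).1.1]

theorem tendsto_startTime (hτ : 0 < τ) {a : ℕ → ℝ × α} (ha : ∀ i, a i ∈ letters 𝓜 τ) :
    Tendsto (startTime a) atTop atTop :=
  tendsto_atTop_mono (mul_le_startTime ha)
    (tendsto_natCast_atTop_atTop.const_mul_atTop hτ)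

theorem exists_mem_Ico_of_tendsto {t : ℕ → ℝ} (ht0 : t 0 = 0) (ht : Tendsto t atTop atTop) {s : ℝ}
    (hs : 0 ≤ s) : ∃ k, s ∈ Ico (t k) (t (k + 1)) := by
  classical
  have hP : ∃ n, s < t n := (ht.eventually (eventually_gt_atTop s)).exists
  have h0 : Nat.find hP ≠ 0 := by
    intro h
    have h1 := Nat.find_spec hP
    rw [h, ht0] at h1
    linarith
  obtain ⟨k, hk⟩ := Nat.exists_eq_succ_of_ne_zero h0
  refine ⟨k, not_lt.1 (Nat.find_min hP (m := k) (by omega)), ?_⟩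
  have h1 := Nat.find_spec hP
  rwa [hk] at h1

/-- `a` lists the durations and the modes of the pieces of the signal `Z`. -/
def Follows (Z : ℝ → α) (a : ℕ → ℝ × α) : Prop :=
  ∀ n, ∀ s ∈ Ico (startTime a n) (startTime a (n + 1)), Z s = (a n).2

theorem exists_signal_follows (hτ : 0 < τ) {a : ℕ → ℝ × α} (ha : ∀ i, a i ∈ letters 𝓜 τ) :
    ∃ Z : Signal 𝓜 τ, Follows Z.1 a := by
  classical
  have hmono := strictMono_startTime hτ ha
  let T := startTime a
  -- The default value is only taken at negative times.
  let Z : ℝ → α := fun s => if h : ∃ k, s ∈ Ico (T k) (T (k + 1)) then (a h.choose).2 else (a 0).2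
  have hZ : Follows Z a := by
    intro k s hk
    have h : ∃ k, s ∈ Ico (T k) (T (k + 1)) := ⟨k, hk⟩
    have h1 : h.choose < k + 1 := hmono.lt_iff_lt.1 (h.choose_spec.1.trans_lt hk.2)
    have h2 : k < h.choose + 1 := hmono.lt_iff_lt.1 (hk.1.trans_lt h.choose_spec.2)
    have h3 : h.choose = k := by omega
    simp only [Z, dif_pos h, h3]
  refine ⟨⟨Z, ⟨fun s _ => ?_, T, startTime_zero a, hmono, fun k => ?_, tendsto_startTime hτ ha,
    fun k s hs => ?_⟩⟩, hZ⟩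
  · by_cases h : ∃ k, s ∈ Ico (T k) (T (k + 1))
    · simp only [Z, dif_pos h]; exact (ha _).2
    · simp only [Z, dif_neg h]; exact (ha _).2
  · change startTime a k + τ ≤ startTime a (k + 1)
    rw [startTime_succ]
    linarith [(ha k).1.1]
  · rw [hZ k s hs, hZ k (T k) ⟨le_rfl, hmono k.lt_succ_self⟩]

/-- Cutting long constant stretches bounds the durations by `2 * τ`, which makes the alphabet
compact and covers signals with finitely many switchings. -/
theorem IsSignal.exists_follows (hτ : 0 < τ) {Z : ℝ → α} (hZ : IsSignal 𝓜 τ Z) :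
    ∃ a : ℕ → ℝ × α, (∀ i, a i ∈ letters 𝓜 τ) ∧ Follows Z a := by
  obtain ⟨t, ht0, htm, htτ, -, htc⟩ := hZ.exists_times
  -- Admissible cutting times are those followed by at least `τ` of the same stretch. From such a
  -- time, advance by `τ` if at least `2 * τ` remain, otherwise to the end of the stretch; the new
  -- time is again admissible.
  let R : Set ℝ := {s | 0 ≤ s ∧ ∃ k, t k ≤ s ∧ s + τ ≤ t (k + 1)}
  have hstep : ∀ s : R, ∃ s' : R, s'.1 - s.1 ∈ Icc τ (2 * τ) ∧ ∀ u ∈ Ico s.1 s'.1, Z u = Z s := by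
    rintro ⟨s, hs0, k, hk1, hk2⟩
    rcases le_or_gt (s + 2 * τ) (t (k + 1)) with h | h
    · refine ⟨⟨s + τ, by linarith, k, by linarith, by linarith⟩, ⟨by simp, by simp; linarith⟩, ?_⟩
      intro u hu
      rw [htc k u ⟨hk1.trans hu.1, hu.2.trans_le hk2⟩, htc k s ⟨hk1, by linarith⟩]
    · refine ⟨⟨t (k + 1), by linarith, k + 1, le_rfl, htτ _⟩, ⟨?_, ?_⟩, ?_⟩
      · change τ ≤ t (k + 1) - s
        linarith
      · change t (k + 1) - s ≤ 2 * τ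
        linarith
      · intro u hu
        rw [htc k u ⟨hk1.trans hu.1, hu.2⟩, htc k s ⟨hk1, by linarith⟩]
  choose nx hnx1 hnx2 using hstep
  let r : ℕ → R := fun n => nx^[n] ⟨0, le_rfl, 0, ht0.le, by simpa [ht0] using htτ 0⟩
  have hr : ∀ n, r (n + 1) = nx (r n) := fun n => Function.iterate_succ_apply' _ _ _
  let a : ℕ → ℝ × α := fun n => ((r (n + 1)).1 - (r n).1, Z (r n).1)
  have hT : ∀ n, startTime a n = (r n).1 := fun n => by
    rw [startTime, Finset.sum_range_sub (fun n => (r n).1)]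
    simp [r]
  refine ⟨a, fun i => ⟨?_, hZ.mem _ (r i).2.1⟩, fun n s hs => ?_⟩
  · change (r (i + 1)).1 - (r i).1 ∈ _
    rw [hr]
    exact hnx1 _
  · rw [hT, hT, hr] at hs
    exact hnx2 _ s hs

variable {ι : Type*} [Fintype ι] [DecidableEq ι]

/-- The flow over one piece of a signal. -/
noncomputable def pieceFlow (F : α → Matrix ι ι ℝ) (x : ℝ × α) :
    EuclideanSpace ℝ ι →L[ℝ] EuclideanSpace ℝ ι :=
  NormedSpace.exp (x.1 • Matrix.toEuclideanCLM (𝕜 := ℝ) (F x.2))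

/-- Uniqueness for the linear equation; it identifies the chosen `flow` with explicit exponentials.
-/
theorem IsSolution.eq_exp_apply {F : α → Matrix ι ι ℝ} {Z : ℝ → α} {x₀ : EuclideanSpace ℝ ι}
    {X : ℝ → EuclideanSpace ℝ ι} (hX : IsSolution F Z x₀ X) {u v : ℝ} (hu : 0 ≤ u) {m : α}
    (hm : ∀ s ∈ Ico u v, Z s = m) {s : ℝ} (hs : s ∈ Icc u v) :
    X s = NormedSpace.exp ((s - u) • Matrix.toEuclideanCLM (𝕜 := ℝ) (F m)) (X u) := by
  set A := Matrix.toEuclideanCLM (𝕜 := ℝ) (F m)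
  have hd : ∀ r, HasDerivAt (fun r : ℝ => NormedSpace.exp ((r - u) • A) (X u))
      (A (NormedSpace.exp ((r - u) • A) (X u))) r := fun r => by
    simpa using ((hasDerivAt_exp_smul_const' (𝕂 := ℝ) A (r - u)).comp_sub_const r u).clm_apply
      (hasDerivAt_const r (X u))
  refine ODE_solution_unique_of_mem_Icc_right (v := fun _ x => A x) (s := fun _ => univ)
    (K := ‖A‖₊) (a := u) (b := v) (fun t _ => A.lipschitz.lipschitzOnWith)
    (hX.cont.mono fun r hr => hu.trans hr.1) (fun t ht => ?_) (fun _ _ => trivial)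
    (fun r _ => (hd r).continuousAt.continuousWithinAt) (fun t _ => (hd t).hasDerivWithinAt)
    (fun _ _ => trivial) (by rw [sub_self, zero_smul ℝ A, NormedSpace.exp_zero]; rfl) hs
  have := hX.deriv t (hu.trans ht.1)
  rwa [hm t ht] at this

variable {F : α → Matrix ι ι ℝ} {a : ℕ → ℝ × α}

theorem flow_eq_exp_mul_flow (hτ : 0 < τ) (ha : ∀ i, a i ∈ letters 𝓜 τ) {Z : Signal 𝓜 τ}
    (hZ : Follows Z.1 a) {n : ℕ} {s : ℝ} (hs : s ∈ Icc (startTime a n) (startTime a (n + 1))) :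
    flow F Z s = NormedSpace.exp ((s - startTime a n) •
      Matrix.toEuclideanCLM (𝕜 := ℝ) (F (a n).2)) * flow F Z (startTime a n) :=
  ContinuousLinearMap.ext fun x₀ =>
    (flow_spec F Z x₀).eq_exp_apply (startTime_nonneg hτ ha n) (hZ n) hs

theorem flow_startTime (hτ : 0 < τ) (ha : ∀ i, a i ∈ letters 𝓜 τ) {Z : Signal 𝓜 τ}
    (hZ : Follows Z.1 a) (n : ℕ) : flow F Z (startTime a n) = wordProd (pieceFlow F) a n := by
  induction n with
  | zero =>
    refine ContinuousLinearMap.ext fun x₀ => ?_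
    simpa [wordProd] using (flow_spec F Z x₀).init
  | succ n ih =>
    rw [flow_eq_exp_mul_flow hτ ha hZ ⟨(strictMono_startTime hτ ha).monotone n.le_succ, le_rfl⟩,
      ih, wordProd, startTime_succ, add_sub_cancel_left]
    rfl

theorem flow_eq_exp_mul_wordProd (hτ : 0 < τ) (ha : ∀ i, a i ∈ letters 𝓜 τ) {Z : Signal 𝓜 τ}
    (hZ : Follows Z.1 a) {n : ℕ} {s : ℝ} (hs : s ∈ Icc (startTime a n) (startTime a (n + 1))) :
    flow F Z s = NormedSpace.exp ((s - startTime a n) •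
      Matrix.toEuclideanCLM (𝕜 := ℝ) (F (a n).2)) * wordProd (pieceFlow F) a n := by
  rw [flow_eq_exp_mul_flow hτ ha hZ hs, flow_startTime hτ ha hZ]

variable {K : ℝ}

theorem norm_pieceFlow_le (hτ : 0 < τ) (hK0 : 0 ≤ K)
    (hK : ∀ m ∈ 𝓜, ‖Matrix.toEuclideanCLM (𝕜 := ℝ) (F m)‖ ≤ K) {x : ℝ × α}
    (hx : x ∈ letters 𝓜 τ) : ‖pieceFlow F x‖ ≤ Real.exp (K * (2 * τ)) :=
  (norm_exp_smul_le (hK _ hx.2) (hτ.le.trans hx.1.1)).trans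
    (Real.exp_le_exp.2 (mul_le_mul_of_nonneg_left hx.1.2 hK0))

end Words

/-! ### Lyapunov exponents in terms of products, and their link with stability. -/

section Exponent

variable {α : Type*} {𝓜 : Set α} {τ : ℝ} {ι : Type*} [Fintype ι] [DecidableEq ι]
  {F : α → Matrix ι ι ℝ}

theorem log_enorm_div_le_iff {E : Type*} [SeminormedAddCommGroup E] (x : E) {s : ℝ} (hs : 0 < s)
    (ν : ℝ) : ENNReal.log ‖x‖ₑ / (s : EReal) ≤ (ν : EReal) ↔ ‖x‖ ≤ Real.exp (ν * s) := by
  rw [EReal.div_le_iff_le_mul (by exact_mod_cast hs) (EReal.coe_ne_top s), ← EReal.coe_mul,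
    ← EReal.exp_le_exp_iff, ENNReal.exp_log, EReal.exp_coe, ← ofReal_norm,
    ENNReal.ofReal_le_ofReal_iff (Real.exp_pos _).le, mul_comm]

theorem lyapunovExponent_le {ν : ℝ}
    (h : ∀ᶠ s : ℝ in atTop, ∀ Z : Signal 𝓜 τ, ‖flow F Z s‖ ≤ Real.exp (ν * s)) :
    lyapunovExponent 𝓜 τ F ≤ ν := by
  refine limsup_le_of_le (by isBoundedDefault) ?_
  filter_upwards [h, eventually_gt_atTop 0] with s hs hs0
  exact iSup_le fun Z => (log_enorm_div_le_iff _ hs0 ν).2 (hs Z)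

theorem eventually_norm_flow_le {ν : ℝ} (h : lyapunovExponent 𝓜 τ F < ν) :
    ∀ᶠ s : ℝ in atTop, ∀ Z : Signal 𝓜 τ, ‖flow F Z s‖ ≤ Real.exp (ν * s) := by
  filter_upwards [eventually_lt_of_limsup_lt h, eventually_gt_atTop 0] with s hs hs0 Z
  exact (log_enorm_div_le_iff _ hs0 ν).1 ((le_iSup
    (fun Z : Signal 𝓜 τ => ENNReal.log ‖flow F Z s‖ₑ / (s : EReal)) Z).trans hs.le)

theorem lyapunovExponent_le_of_norm_flow_le {C ν : ℝ}
    (h : ∀ Z : Signal 𝓜 τ, ∀ s, 0 ≤ s → ‖flow F Z s‖ ≤ C * Real.exp (ν * s)) :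
    lyapunovExponent 𝓜 τ F ≤ ν := by
  refine EReal.le_of_forall_lt_iff_le.1 fun ν' hν' => lyapunovExponent_le ?_
  have hlt : ν < ν' := by exact_mod_cast hν'
  have h1 : Tendsto (fun s : ℝ => Real.exp ((ν' - ν) * s)) atTop atTop :=
    Real.tendsto_exp_atTop.comp (tendsto_id.const_mul_atTop (sub_pos.2 hlt))
  filter_upwards [h1.eventually_ge_atTop C, eventually_ge_atTop 0] with s hs hs0 Z
  refine (h Z s hs0).trans ((mul_le_mul_of_nonneg_right hs (Real.exp_pos _).le).trans_eq ?_)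
  rw [← Real.exp_add]
  ring_nf

variable {K : ℝ}

theorem exists_norm_wordProd_le_of_lyapunovExponent_lt (hτ : 0 < τ) (hK0 : 0 ≤ K)
    (hK : ∀ m ∈ 𝓜, ‖Matrix.toEuclideanCLM (𝕜 := ℝ) (F m)‖ ≤ K) {ν : ℝ}
    (h : lyapunovExponent 𝓜 τ F < ν) :
    ∃ C, 0 ≤ C ∧ ∀ a : ℕ → ℝ × α, (∀ i, a i ∈ letters 𝓜 τ) → ∀ n,
      ‖wordProd (pieceFlow F) a n‖ ≤ C * Real.exp (ν * startTime a n) := by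
  obtain ⟨s₀, hs₀⟩ := eventually_atTop.1 (eventually_norm_flow_le h)
  -- This constant absorbs the words that end before time `s₀`, where only the crude bound `exp (K
  -- t)` is available.
  refine ⟨Real.exp ((K + |ν|) * |s₀|), (Real.exp_pos _).le, fun a ha n => ?_⟩
  have hT := startTime_nonneg hτ ha n
  rcases le_or_gt s₀ (startTime a n) with h1 | h1
  · obtain ⟨Z, hZ⟩ := exists_signal_follows hτ ha
    have h2 := hs₀ _ h1 Z
    rw [flow_startTime hτ ha hZ] at h2
    exact h2.trans (le_mul_of_one_le_left (Real.exp_pos _).le (Real.one_le_exp (by positivity)))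
  · have h2 : ∀ n, ‖wordProd (pieceFlow F) a n‖ ≤ Real.exp (K * startTime a n) := by
      intro n
      induction n with
      | zero => simpa [wordProd, ContinuousLinearMap.one_def] using
          ContinuousLinearMap.norm_id_le (𝕜 := ℝ) (E := EuclideanSpace ℝ ι)
      | succ n ih =>
        rw [wordProd, startTime_succ, mul_add, add_comm, Real.exp_add]
        exact (norm_mul_le _ _).trans (mul_le_mul
          (norm_exp_smul_le (hK _ (ha n).2) (hτ.le.trans (ha n).1.1)) ih (norm_nonneg _)
          (Real.exp_pos _).le)
    refine (h2 n).trans ?_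
    rw [← Real.exp_add]
    refine Real.exp_le_exp.2 ?_
    have h3 : startTime a n ≤ |s₀| := h1.le.trans (le_abs_self _)
    have h4 := neg_abs_le ν
    nlinarith [abs_nonneg ν]

theorem exists_norm_flow_le_of_norm_wordProd_le (hτ : 0 < τ) (hK0 : 0 ≤ K)
    (hK : ∀ m ∈ 𝓜, ‖Matrix.toEuclideanCLM (𝕜 := ℝ) (F m)‖ ≤ K) {C ν : ℝ}
    (h : ∀ a : ℕ → ℝ × α, (∀ i, a i ∈ letters 𝓜 τ) → ∀ n,
      ‖wordProd (pieceFlow F) a n‖ ≤ C * Real.exp (ν * startTime a n)) :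
    ∃ C' > 0, ∀ Z : Signal 𝓜 τ, ∀ s, 0 ≤ s → ‖flow F Z s‖ ≤ C' * Real.exp (ν * s) := by
  -- The first factor pays for the unfinished last piece: at most `2 * τ` of flow, and the time
  -- shift in `exp (ν s)` for either sign of `ν`.
  refine ⟨Real.exp ((K + |ν|) * (2 * τ)) * (|C| + 1), by positivity, fun Z s hs => ?_⟩
  obtain ⟨a, ha, hZ⟩ := Z.2.exists_follows hτ
  obtain ⟨n, hn⟩ := exists_mem_Ico_of_tendsto (startTime_zero a) (tendsto_startTime hτ ha) hs
  have hn' := hn.2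
  rw [startTime_succ] at hn'
  have h1 : s - startTime a n ≤ 2 * τ := by linarith [(ha n).1.2]
  have h0 : 0 ≤ s - startTime a n := by linarith [hn.1]
  rw [flow_eq_exp_mul_wordProd hτ ha hZ ⟨hn.1, hn.2.le⟩]
  calc _ ≤ Real.exp (K * (s - startTime a n)) * ((|C| + 1) * Real.exp (ν * startTime a n)) :=
        (norm_mul_le _ _).trans (mul_le_mul (norm_exp_smul_le (hK _ (ha n).2) h0)
          ((h a ha n).trans (mul_le_mul_of_nonneg_right (by linarith [le_abs_self C])
            (Real.exp_pos _).le)) (norm_nonneg _) (Real.exp_pos _).le)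
    _ = (|C| + 1) * Real.exp (K * (s - startTime a n) + ν * startTime a n) := by
        rw [Real.exp_add]; ring
    _ ≤ (|C| + 1) * Real.exp ((K + |ν|) * (2 * τ) + ν * s) := by
        refine mul_le_mul_of_nonneg_left (Real.exp_le_exp.2 ?_) (by positivity)
        have h4 := neg_abs_le ν
        nlinarith [abs_nonneg ν]
    _ = _ := by rw [Real.exp_add]; ring

theorem isES_of_lyapunovExponent_neg (hτ : 0 < τ) (hK0 : 0 ≤ K)
    (hK : ∀ m ∈ 𝓜, ‖Matrix.toEuclideanCLM (𝕜 := ℝ) (F m)‖ ≤ K)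
    (h : lyapunovExponent 𝓜 τ F < 0) : IsES 𝓜 τ F := by
  obtain ⟨ν, h1, h2⟩ := EReal.lt_iff_exists_real_btwn.1 h
  obtain ⟨C, -, hC⟩ := exists_norm_wordProd_le_of_lyapunovExponent_lt hτ hK0 hK h1
  obtain ⟨C', hC', H⟩ := exists_norm_flow_le_of_norm_wordProd_le hτ hK0 hK hC
  exact ⟨C', hC', -ν, neg_pos.2 (by exact_mod_cast h2), by simpa using H⟩

theorem IsES.lyapunovExponent_neg (h : IsES 𝓜 τ F) : lyapunovExponent 𝓜 τ F < 0 := by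
  obtain ⟨c, -, δ, hδ, H⟩ := h
  exact (lyapunovExponent_le_of_norm_flow_le H).trans_lt (by exact_mod_cast neg_neg_of_pos hδ)

theorem IsEU.lyapunovExponent_pos (h : IsEU 𝓜 τ F) : 0 < lyapunovExponent 𝓜 τ F := by
  obtain ⟨c, hc, δ, hδ, Z, x₀, hx₀, H⟩ := h
  by_contra hle
  have hlt : lyapunovExponent 𝓜 τ F < ((δ / 2 : ℝ) : EReal) :=
    (not_lt.1 hle).trans_lt (by exact_mod_cast half_pos hδ)
  have h1 : Tendsto (fun s : ℝ => c * Real.exp (δ / 2 * s)) atTop atTop :=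
    (Real.tendsto_exp_atTop.comp (tendsto_id.const_mul_atTop (half_pos hδ))).const_mul_atTop hc
  obtain ⟨s, h2, h3, h4⟩ := ((eventually_norm_flow_le hlt).and
    ((h1.eventually_gt_atTop 1).and (eventually_ge_atTop 0))).exists
  have h5 := (H s h4).trans ((flow F Z s).le_opNorm x₀)
  have h6 := (le_of_mul_le_mul_right h5 (norm_pos_iff.2 hx₀)).trans (h2 Z)
  have h7 : Real.exp (δ * s) = Real.exp (δ / 2 * s) * Real.exp (δ / 2 * s) := by
    rw [← Real.exp_add]; ring_nf
  rw [h7, ← mul_assoc] at h6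
  have h8 := Real.exp_pos (δ / 2 * s)
  nlinarith

end Exponent

/-! ### From a positive exponent to an exponentially growing trajectory. -/

section Unstable

variable {α : Type*} {𝓜 : Set α} {τ : ℝ} {ι : Type*} [Fintype ι] [DecidableEq ι]
  [Nonempty ι] {F : α → Matrix ι ι ℝ} {K : ℝ}

/-- A positive exponent yields arbitrarily long trajectories that dominate an exponential at all
their switching times. -/
theorem exists_growing_word (hτ : 0 < τ) (hK0 : 0 ≤ K)
    (hK : ∀ m ∈ 𝓜, ‖Matrix.toEuclideanCLM (𝕜 := ℝ) (F m)‖ ≤ K) {μ : ℝ} (hμ : 0 < μ)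
    (h : (μ : EReal) < lyapunovExponent 𝓜 τ F) (L : ℕ) :
    ∃ a : ℕ → ℝ × α, (∀ i, a i ∈ letters 𝓜 τ) ∧ ∃ y : EuclideanSpace ℝ ι, ‖y‖ = 1 ∧
      ∀ j ≤ L, Real.exp (μ * startTime a j) ≤ ‖wordProd (pieceFlow F) a j y‖ := by
  set k₀ := Real.exp (K * (2 * τ))
  have hk₀ : 1 ≤ k₀ := Real.one_le_exp (by positivity)
  obtain ⟨a, ha, n, x, hx⟩ : ∃ a : ℕ → ℝ × α, (∀ i, a i ∈ letters 𝓜 τ) ∧ ∃ n,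
      ∃ x : EuclideanSpace ℝ ι,
        k₀ ^ L * Real.exp (μ * startTime a n) * ‖x‖ < ‖wordProd (pieceFlow F) a n x‖ := by
    by_contra! hcon
    obtain ⟨C', -, H⟩ := exists_norm_flow_le_of_norm_wordProd_le (F := F) (𝓜 := 𝓜) hτ hK0 hK
      (C := k₀ ^ L) (ν := μ) fun a ha n =>
        ContinuousLinearMap.opNorm_le_bound _ (by positivity) (hcon a ha n)
    exact (lyapunovExponent_le_of_norm_flow_le H).not_gt h
  -- Restarting at a minimum of the normalised norm `g` makes every later switching time dominate
  -- the exponential.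
  let g : ℕ → ℝ := fun k => ‖wordProd (pieceFlow F) a k x‖ * Real.exp (-(μ * startTime a k))
  obtain ⟨k, hk, hmin⟩ := Finset.exists_min_image (Finset.range (n + 1)) g ⟨0, by simp⟩
  have hkn : k ≤ n := by simpa [Nat.lt_succ_iff] using hk
  set y := wordProd (pieceFlow F) a k x
  let b : ℕ → ℝ × α := fun i => a (k + i)
  have hb : ∀ i, b i ∈ letters 𝓜 τ := fun i => ha _
  have hsplit : ∀ j, wordProd (pieceFlow F) a (k + j) x = wordProd (pieceFlow F) b j y :=
    fun j => by rw [wordProd_add]; rfl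
  have hgn : k₀ ^ L * ‖x‖ < g n := by
    have := mul_lt_mul_of_pos_right hx (Real.exp_pos (-(μ * startTime a n)))
    refine lt_of_eq_of_lt ?_ this
    rw [mul_right_comm, mul_assoc (k₀ ^ L), ← Real.exp_add, add_neg_cancel, Real.exp_zero, mul_one]
  have hg0 : g k ≤ ‖x‖ := by simpa [g, wordProd] using hmin 0 (by simp)
  have hgn' : g n ≤ k₀ ^ (n - k) * g k := by
    obtain ⟨j, rfl⟩ := Nat.exists_eq_add_of_le hkn
    have h1 : ‖wordProd (pieceFlow F) b j y‖ ≤ k₀ ^ j * ‖y‖ := by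
      refine ((wordProd (pieceFlow F) b j).le_opNorm y).trans ?_
      exact mul_le_mul_of_nonneg_right
        (norm_wordProd_le (fun i => norm_pieceFlow_le hτ hK0 hK (hb i)) j) (norm_nonneg _)
    simp only [g, hsplit, Nat.add_sub_cancel_left]
    rw [← mul_assoc]
    refine mul_le_mul h1 (Real.exp_le_exp.2 ?_) (Real.exp_pos _).le (by positivity)
    have := (strictMono_startTime hτ ha).monotone hkn
    nlinarith
  have hy : 0 < ‖y‖ := by
    by_contra hy0
    have : g k = 0 := by simp [g, y, le_antisymm (not_lt.1 hy0) (norm_nonneg _)]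
    rw [this, mul_zero] at hgn'
    have : 0 ≤ k₀ ^ L * ‖x‖ := by positivity
    linarith
  -- Each letter raises `g` by a factor of at most `k₀`. Since `g k ≤ ‖x‖` and `g n > k₀ ^ L * ‖x‖`,
  -- more than `L` letters remain after the minimum.
  have hL : L < n - k := by
    by_contra! hle
    have h1 := pow_le_pow_right₀ hk₀ hle
    have h2 : k₀ ^ (n - k) * g k ≤ k₀ ^ L * ‖x‖ := mul_le_mul h1 hg0 (by positivity) (by positivity)
    linarith
  refine ⟨b, hb, ‖y‖⁻¹ • y, by rw [norm_smul, norm_inv, norm_norm, inv_mul_cancel₀ hy.ne'],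
    fun j hj => ?_⟩
  have h1 := hmin (k + j) (by simp; omega)
  simp only [g, hsplit, startTime_add a k j] at h1
  rw [map_smul, norm_smul, norm_inv, norm_norm, inv_mul_eq_div, le_div_iff₀ hy]
  have h2 : ‖y‖ ≤ ‖wordProd (pieceFlow F) b j y‖ * Real.exp (-(μ * startTime b j)) := by
    rw [mul_add, neg_add, add_comm, Real.exp_add, ← mul_assoc] at h1
    exact le_of_mul_le_mul_right h1 (Real.exp_pos _)
  calc _ ≤ Real.exp (μ * startTime b j) *
        (‖wordProd (pieceFlow F) b j y‖ * Real.exp (-(μ * startTime b j))) := by gcongr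
    _ = _ := by rw [mul_left_comm, ← Real.exp_add, add_neg_cancel, Real.exp_zero, mul_one]

theorem isEU_of_lyapunovExponent_pos [TopologicalSpace α] [T2Space α]
    (hτ : 0 < τ)
    (h𝓜 : IsCompact 𝓜) (hF : Continuous F) (h : 0 < lyapunovExponent 𝓜 τ F) : IsEU 𝓜 τ F := by
  have hFc : Continuous fun m => Matrix.toEuclideanCLM (𝕜 := ℝ) (F m) :=
    Matrix.continuous_toEuclideanCLM.comp hF
  obtain ⟨K, hK⟩ := h𝓜.exists_bound_of_continuousOn hFc.continuousOn
  have hK' : ∀ m ∈ 𝓜, ‖Matrix.toEuclideanCLM (𝕜 := ℝ) (F m)‖ ≤ |K| := fun m hm =>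
    (hK m hm).trans (le_abs_self K)
  obtain ⟨μ, h1, h2⟩ := EReal.lt_iff_exists_real_btwn.1 h
  have hμ : 0 < μ := by exact_mod_cast h1
  -- Pairs of an infinite word and a unit vector form a compact space by Tychonoff. The sets `Γ L`
  -- are closed, nested and nonempty, so a common point grows at all switching times.
  let Γ : ℕ → Set ((ℕ → ℝ × α) × EuclideanSpace ℝ ι) := fun L =>
    ((univ.pi fun _ => letters 𝓜 τ) ×ˢ Metric.sphere 0 1) ∩
      {p | ∀ j ≤ L, Real.exp (μ * startTime p.1 j) ≤ ‖wordProd (pieceFlow F) p.1 j p.2‖}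
  have hpc : Continuous (pieceFlow F) :=
    continuous_exp_clm.comp (continuous_fst.smul (hFc.comp continuous_snd))
  have hwc : ∀ j, Continuous fun a : ℕ → ℝ × α => wordProd (pieceFlow F) a j := by
    intro j
    induction j with
    | zero => exact continuous_const
    | succ j ih => exact (hpc.comp (continuous_apply j)).mul ih
  have hΓ₀ : IsCompact ((univ.pi fun _ : ℕ => letters 𝓜 τ) ×ˢ
      Metric.sphere (0 : EuclideanSpace ℝ ι) 1) :=
    (isCompact_univ_pi fun _ => isCompact_Icc.prod h𝓜).prod (isCompact_sphere _ _)
  have hclosed : ∀ L, IsClosed {p : (ℕ → ℝ × α) × EuclideanSpace ℝ ι |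
      ∀ j ≤ L, Real.exp (μ * startTime p.1 j) ≤ ‖wordProd (pieceFlow F) p.1 j p.2‖} := by
    intro L
    simp only [ofPred_forall]
    refine isClosed_iInter fun j => isClosed_iInter fun _ => isClosed_le ?_ ?_
    · have : Continuous fun p : (ℕ → ℝ × α) × EuclideanSpace ℝ ι => startTime p.1 j :=
        continuous_finsetSum _ fun i _ => continuous_fst.comp
          ((continuous_apply i).comp continuous_fst)
      fun_prop
    · exact (((hwc j).comp continuous_fst).clm_apply continuous_snd).norm
  obtain ⟨⟨a, y⟩, hay⟩ : (⋂ L, Γ L).Nonempty := by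
    refine IsCompact.nonempty_iInter_of_sequence_nonempty_isCompact_isClosed Γ
      (fun L p hp => ⟨hp.1, fun j hj => hp.2 j (hj.trans L.le_succ)⟩) (fun L => ?_)
      (hΓ₀.inter_right (hclosed 0)) fun L => hΓ₀.isClosed.inter (hclosed L)
    obtain ⟨a, ha, y, hy, H⟩ := exists_growing_word hτ (abs_nonneg K) hK' hμ h2 L
    exact ⟨(a, y), ⟨fun i _ => ha i, by simpa using hy⟩, H⟩
  rw [mem_iInter] at hay
  have ha : ∀ i, a i ∈ letters 𝓜 τ := fun i => (hay 0).1.1 i trivial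
  have hy : ‖y‖ = 1 := by simpa using (hay 0).1.2
  have H : ∀ j, Real.exp (μ * startTime a j) ≤ ‖wordProd (pieceFlow F) a j y‖ := fun j =>
    (hay j).2 j le_rfl
  obtain ⟨Z, hZ⟩ := exists_signal_follows hτ ha
  refine ⟨Real.exp (-(|K| * (2 * τ))), Real.exp_pos _, μ, hμ, Z, y, ?_, fun s hs => ?_⟩
  · rintro rfl
    simp at hy
  obtain ⟨n, hn⟩ := exists_mem_Ico_of_tendsto (startTime_zero a) (tendsto_startTime hτ ha) hs
  have hn1 := startTime_succ a n
  set A := Matrix.toEuclideanCLM (𝕜 := ℝ) (F (a n).2)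
  have h3 : flow F Z (startTime a (n + 1)) y =
      NormedSpace.exp ((startTime a (n + 1) - s) • A) (flow F Z s y) := by
    rw [flow_eq_exp_mul_wordProd hτ ha hZ ⟨hn.1, hn.2.le⟩,
      flow_eq_exp_mul_wordProd hτ ha hZ ⟨hn.1.trans hn.2.le, le_rfl⟩,
      ← sub_add_sub_cancel (startTime a (n + 1)) s, exp_add_smul, mul_assoc]
    rfl
  have h4 := H (n + 1)
  rw [← flow_startTime hτ ha hZ, h3] at h4
  -- Between switching times the lower bound is read off at the end of the piece, since the rest of
  -- the piece amplifies by at most `exp (|K| * (2 * τ))`.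
  have h5 : Real.exp (μ * startTime a (n + 1)) ≤ Real.exp (|K| * (2 * τ)) * ‖flow F Z s y‖ := by
    refine h4.trans ((ContinuousLinearMap.le_opNorm _ _).trans ?_)
    refine mul_le_mul_of_nonneg_right ((norm_exp_smul_le (hK' _ (ha n).2)
      (sub_nonneg.2 hn.2.le)).trans (Real.exp_le_exp.2 ?_)) (norm_nonneg _)
    refine mul_le_mul_of_nonneg_left ?_ (abs_nonneg K)
    linarith [(ha n).1.2, hn.1]
  rw [hy, mul_one]
  calc _ ≤ Real.exp (-(|K| * (2 * τ))) * Real.exp (μ * startTime a (n + 1)) := by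
        gcongr; exact hn.2.le
    _ ≤ Real.exp (-(|K| * (2 * τ))) * (Real.exp (|K| * (2 * τ)) * ‖flow F Z s y‖) := by gcongr
    _ = _ := by rw [← mul_assoc, ← Real.exp_add, neg_add_cancel, Real.exp_zero, one_mul]

end Unstable

end SwitchedSystem

/-! ### Quadratic Lyapunov functions of Hurwitz matrices. -/

theorem tendsto_pow_zero_of_spectralRadius_lt_one {A : Type*} [NormedRing A] [NormedAlgebra ℂ A]
    [CompleteSpace A] {a : A} (h : spectralRadius ℂ a < 1) :
    Tendsto (fun n : ℕ => a ^ n) atTop (𝓝 0) := by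
  obtain ⟨r, h1, h2⟩ := ENNReal.lt_iff_exists_nnreal_btwn.1 h
  have hr : (r : ℝ) < 1 := by exact_mod_cast h2
  refine squeeze_zero_norm' ?_ (tendsto_pow_atTop_nhds_zero_of_lt_one r.2 hr)
  filter_upwards [(spectrum.pow_nnnorm_pow_one_div_tendsto_nhds_spectralRadius a).eventually_lt_const
    h1, eventually_gt_atTop 0] with n hn hn0
  have hn' : (0 : ℝ) < n := by exact_mod_cast hn0
  have h3 := ENNReal.rpow_lt_rpow hn hn'
  rw [← ENNReal.rpow_mul, one_div_mul_cancel hn'.ne', ENNReal.rpow_one, ENNReal.rpow_natCast] at h3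
  exact_mod_cast h3.le

section Lyapunov

variable {ι : Type*} [Fintype ι] [DecidableEq ι]

/-- An explicit Euler step turns Hurwitz into Schur stability: `|1 + η w|² = 1 + 2 η Re w + η² |w|²`
is less than one for small `η`, and there are finitely many eigenvalues. -/
theorem Matrix.IsHurwitz.exists_pos_forall_norm_lt_one {D : Matrix ι ι ℝ} (hD : D.IsHurwitz) :
    ∃ η : ℝ, 0 < η ∧ ∀ z ∈ spectrum ℂ ((1 + η • D).map (algebraMap ℝ ℂ)), ‖z‖ < 1 := by
  set Dc := D.map (algebraMap ℝ ℂ)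
  have hev : ∀ᶠ η : ℝ in 𝓝[>] 0, ∀ w ∈ spectrum ℂ Dc, ‖1 + η * w‖ < 1 := by
    refine (Matrix.finite_spectrum Dc).eventually_all.2 fun w hw => ?_
    have hre := hD w hw
    have h1 : ∀ᶠ η : ℝ in 𝓝[>] 0, η * ‖w‖ ^ 2 < -(2 * w.re) := by
      have h2 : Tendsto (fun η : ℝ => η * ‖w‖ ^ 2) (𝓝[>] 0) (𝓝 0) := by
        have h : Continuous fun η : ℝ => η * ‖w‖ ^ 2 := by fun_prop
        simpa using (h.tendsto 0).mono_left nhdsWithin_le_nhds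
      exact h2.eventually_lt_const (by linarith)
    filter_upwards [h1, self_mem_nhdsWithin] with η h3 h4
    have h4' : 0 < η := h4
    rw [← sq_lt_one_iff₀ (norm_nonneg _), Complex.sq_norm, Complex.normSq_apply]
    rw [Complex.sq_norm, Complex.normSq_apply] at h3
    simp only [Complex.add_re, Complex.one_re, Complex.mul_re, Complex.ofReal_re,
      Complex.ofReal_im, zero_mul, sub_zero, Complex.add_im, Complex.one_im, Complex.mul_im,
      add_zero, zero_add]
    nlinarith
  obtain ⟨η, h1, h2⟩ := (hev.and self_mem_nhdsWithin).exists
  have hη : 0 < η := h2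
  have hηc : (η : ℂ) ≠ 0 := by exact_mod_cast hη.ne'
  refine ⟨η, hη, fun z hz => ?_⟩
  have hmap : (1 + η • D).map (algebraMap ℝ ℂ) = 1 + (η : ℂ) • Dc := by
    ext i j
    by_cases h : i = j <;> simp [Dc, h]
  have h3 : (z - 1) / η ∈ spectrum ℂ Dc := by
    rw [spectrum.mem_iff] at hz ⊢
    refine fun hu => hz ?_
    have h4 : (algebraMap ℂ (Matrix ι ι ℂ)) z - (1 + η • D).map (algebraMap ℝ ℂ) =
        (η : ℂ) • ((algebraMap ℂ (Matrix ι ι ℂ)) ((z - 1) / η) - Dc) := by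
      rw [hmap, smul_sub, Algebra.algebraMap_eq_smul_one, Algebra.algebraMap_eq_smul_one, smul_smul,
        mul_div_cancel₀ _ hηc, sub_smul, one_smul, sub_sub]
    rw [h4]
    exact hu.smul (Units.mk0 (η : ℂ) hηc)
  have h5 := h1 _ h3
  rwa [mul_div_cancel₀ _ hηc, add_sub_cancel] at h5

theorem Matrix.tendsto_pow_zero_of_norm_lt_one [Nonempty ι] {W : Matrix ι ι ℝ}
    (hW : ∀ z ∈ spectrum ℂ (W.map (algebraMap ℝ ℂ)), ‖z‖ < 1) :
    Tendsto (fun n : ℕ => W ^ n) atTop (𝓝 0) := by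
  let f := Matrix.toEuclideanCLM (𝕜 := ℂ) (n := ι)
  have h1 : spectralRadius ℂ (f (W.map (algebraMap ℝ ℂ))) < 1 := by
    refine spectrum.spectralRadius_lt_of_forall_lt (r := 1) _ fun z hz => ?_
    rw [AlgEquiv.spectrum_eq] at hz
    exact_mod_cast hW z hz
  have h2 := tendsto_pow_zero_of_spectralRadius_lt_one h1
  refine tendsto_pi_nhds.2 fun i => tendsto_pi_nhds.2 fun j => ?_
  have h3 : Continuous fun T : EuclideanSpace ℂ ι →L[ℂ] EuclideanSpace ℂ ι =>
      (T (EuclideanSpace.single j 1) i).re := by fun_prop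
  have h4 := (h3.tendsto 0).comp h2
  refine (tendsto_congr fun n => ?_).1 h4
  have h5 : f (W.map (algebraMap ℝ ℂ)) ^ n = f ((W ^ n).map (algebraMap ℝ ℂ)) := by
    rw [← map_pow, Matrix.map_pow]
  simp only [Function.comp, h5]
  simp [f, Matrix.ofLp_toEuclideanCLM]

/-- A Hurwitz matrix admits a quadratic Lyapunov function. -/
theorem Matrix.IsHurwitz.exists_lyapunov [Nonempty ι] {D : Matrix ι ι ℝ} (hD : D.IsHurwitz) :
    ∃ P : EuclideanSpace ℝ ι →L[ℝ] EuclideanSpace ℝ ι,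
      (∀ x y, inner ℝ (P x) y = inner ℝ x (P y)) ∧ (∀ x, ‖x‖ ^ 2 ≤ inner ℝ (P x) x) ∧
      ∃ κ > 0, ∀ x, inner ℝ (P x) (Matrix.toEuclideanCLM (𝕜 := ℝ) D x) ≤ -κ * ‖x‖ ^ 2 := by
  obtain ⟨η, hη, hspec⟩ := hD.exists_pos_forall_norm_lt_one
  set T := Matrix.toEuclideanCLM (𝕜 := ℝ) D
  set W : EuclideanSpace ℝ ι →L[ℝ] EuclideanSpace ℝ ι := 1 + η • T
  have hW : Tendsto (fun n : ℕ => ‖W ^ n‖) atTop (𝓝 0) := by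
    have h1 := ((Matrix.continuous_toEuclideanCLM.tendsto _).comp
      (Matrix.tendsto_pow_zero_of_norm_lt_one hspec)).norm
    simp only [map_zero, norm_zero] at h1
    refine (tendsto_congr fun n => ?_).1 h1
    simp [W, T, map_pow]
  obtain ⟨n, hn, hn0⟩ := ((hW.eventually_lt_const (show (0 : ℝ) < 1 / 2 by norm_num)).and
    (eventually_gt_atTop 0)).exists
  -- A truncated discrete Lyapunov sum suffices: applying `W` shifts the sum, so the form changes by
  -- `‖W ^ n x‖² - ‖x‖² ≤ -(3 / 4) ‖x‖²`. Its term `k = 0` gives the lower bound `‖x‖²`.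
  let P : EuclideanSpace ℝ ι →L[ℝ] EuclideanSpace ℝ ι :=
    ∑ k ∈ Finset.range n, ContinuousLinearMap.adjoint (W ^ k) ∘L (W ^ k)
  have hP : ∀ x y, inner ℝ (P x) y = ∑ k ∈ Finset.range n, inner ℝ ((W ^ k) x) ((W ^ k) y) := by
    intro x y
    simp only [P, _root_.sum_apply, sum_inner, ContinuousLinearMap.comp_apply,
      ContinuousLinearMap.adjoint_inner_left]
  have hPs : ∀ x y, inner ℝ (P x) y = inner ℝ x (P y) := fun x y => by
    rw [← real_inner_comm x, hP, hP]
    exact Finset.sum_congr rfl fun k _ => real_inner_comm _ _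
  have hPn : ∀ x, inner ℝ (P x) x = ∑ k ∈ Finset.range n, ‖(W ^ k) x‖ ^ 2 := fun x => by
    simp [hP]
  have hWx : ∀ x, inner ℝ (P (W x)) (W x) + ‖x‖ ^ 2 = inner ℝ (P x) x + ‖(W ^ n) x‖ ^ 2 := by
    intro x
    have h1 := Finset.sum_range_succ (fun k => ‖(W ^ k) x‖ ^ 2) n
    rw [Finset.sum_range_succ'] at h1
    simpa [hPn, pow_succ] using h1
  -- With `W = 1 + η T`, the decrease reads `2 η ⟨P x, T x⟩ + η² ⟨P T x, T x⟩ ≤ -(3 / 4) ‖x‖²`. The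
  -- second term is nonnegative and is dropped.
  refine ⟨P, hPs, fun x => ?_, 3 / (8 * η), by positivity, fun x => ?_⟩
  · rw [hPn]
    exact (le_of_eq (by simp)).trans (Finset.single_le_sum (f := fun k => ‖(W ^ k) x‖ ^ 2)
      (fun k _ => sq_nonneg _) (Finset.mem_range.2 hn0))
  · have h1 := hWx x
    have h2 : W x = x + η • T x := by simp [W]
    have h3 : inner ℝ (P (T x)) x = inner ℝ (P x) (T x) := by rw [hPs, real_inner_comm]
    have h4 : 0 ≤ inner ℝ (P (T x)) (T x) := by rw [hPn]; positivity
    rw [h2, map_add, map_smul, inner_add_left, inner_add_right, inner_add_right, inner_smul_left,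
      inner_smul_left, inner_smul_right, inner_smul_right, h3] at h1
    simp only [conj_trivial] at h1
    have h5 : ‖(W ^ n) x‖ ^ 2 ≤ (1 / 2 * ‖x‖) ^ 2 :=
      pow_le_pow_left₀ (norm_nonneg _) (((W ^ n).le_opNorm x).trans
        (mul_le_mul_of_nonneg_right hn.le (norm_nonneg _))) 2
    have h6 : 0 ≤ η * (η * inner ℝ (P (T x)) (T x)) := by positivity
    rw [neg_mul, div_mul_eq_mul_div, ← neg_div, le_div_iff₀ (by positivity)]
    nlinarith

end Lyapunov

/-! ### Tikhonov's estimate, with constants uniform in the operators. -/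

section Gronwall

theorem le_of_hasDerivAt_le_mul_add {f f' : ℝ → ℝ} {a b T : ℝ} (ha : a ≠ 0)
    (hf : ∀ t, HasDerivAt f (f' t) t) (h : ∀ t, 0 ≤ t → t ≤ T → f' t ≤ a * f t + b) {t : ℝ}
    (ht : 0 ≤ t) (htT : t ≤ T) :
    f t ≤ f 0 * Real.exp (a * t) + b / a * (Real.exp (a * t) - 1) := by
  have := le_gronwallBound_of_liminf_deriv_right_le (f := f) (f' := f') (δ := f 0) (K := a) (ε := b)
    (a := 0) (b := T) (fun s _ => (hf s).continuousAt.continuousWithinAt)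
    (fun s _ r hr => (hf s).hasDerivWithinAt.liminf_right_slope_le hr) le_rfl
    (fun s hs => h s hs.1 hs.2.le) t ⟨ht, htT⟩
  rwa [sub_zero, gronwallBound_of_K_ne_0 ha] at this

variable {X Y : Type*} [NormedAddCommGroup X] [InnerProductSpace ℝ X] [NormedAddCommGroup Y]
  [InnerProductSpace ℝ Y]

theorem abs_inner_clm_le (A : Y →L[ℝ] X) {K : ℝ} (hA : ‖A‖ ≤ K) (u : X) (w : Y) :
    |inner ℝ u (A w)| ≤ K * (‖u‖ * ‖w‖) := by
  calc |inner ℝ u (A w)| ≤ ‖u‖ * ‖A w‖ := abs_real_inner_le_norm _ _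
    _ ≤ ‖u‖ * (K * ‖w‖) :=
        mul_le_mul_of_nonneg_left ((A.le_opNorm w).trans
          (mul_le_mul_of_nonneg_right hA (norm_nonneg _))) (norm_nonneg _)
    _ = _ := by ring

set_option maxHeartbeats 800000 in
/-- Tikhonov's estimate for `x' = R x + B z`, `z' = ε⁻¹ D z + L x + H z` against `x̄' = R x̄`. -/
theorem exists_tikhonov_bound {K κ T : ℝ} (hK : 1 ≤ K) (hκ : 0 < κ) :
    ∃ ε₀ > 0, ∃ C, 0 ≤ C ∧ ∃ α > 0, ∀ ε, 0 < ε → ε < ε₀ →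
      ∀ (R : X →L[ℝ] X) (B : Y →L[ℝ] X) (L : X →L[ℝ] Y) (D H P : Y →L[ℝ] Y),
      ‖R‖ ≤ K → ‖B‖ ≤ K → ‖L‖ ≤ K → ‖H‖ ≤ K → ‖P‖ ≤ K →
      (∀ x y, inner ℝ (P x) y = inner ℝ x (P y)) → (∀ y, ‖y‖ ^ 2 ≤ inner ℝ (P y) y) →
      (∀ y, inner ℝ (P y) (D y) ≤ -κ * ‖y‖ ^ 2) →
      ∀ (x x' : ℝ → X) (z : ℝ → Y),
      (∀ t, HasDerivAt x (R (x t) + B (z t)) t) →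
      (∀ t, HasDerivAt z (ε⁻¹ • D (z t) + L (x t) + H (z t)) t) →
      (∀ t, HasDerivAt x' (R (x' t)) t) → x' 0 = x 0 →
      ∀ N, ‖x 0‖ ≤ N → ‖z 0‖ ≤ N → ∀ t, 0 ≤ t → t ≤ T →
      ‖x t - x' t‖ ^ 2 ≤ C * ε * N ^ 2 ∧
        ‖z t‖ ^ 2 ≤ C * (Real.exp (-(α / ε) * t) + ε) * N ^ 2 := by
  set q := K ^ 2 with hq
  have hKq : K ≤ q := by nlinarith
  have hK0 : 0 < K := by linarith
  have hq0 : 0 < q := by positivity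
  set C₁ := (1 + K) * Real.exp (7 * q * T)
  have hC₁ : 0 < C₁ := by positivity
  set C₂ := 2 * q ^ 2 * C₁ / κ with hC₂
  have hC₂0 : 0 < C₂ := by positivity
  set α := κ / K with hα
  have hα0 : 0 < α := by positivity
  set C₃ := Real.exp (3 * K * T) * (K ^ 2 / α + C₂ / (3 * α)) with hC₃
  have hC₃0 : 0 < C₃ := by positivity
  -- The bound `κ / (6 * q)` ensures `2 * q ≤ κ / (2 * ε)`, so that the fast dissipation absorbs the
  -- term in `H`; `ε < 1` allows bounding `ε ^ 2` by `ε`.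
  refine ⟨min 1 (κ / (6 * q)), by positivity, K + C₂ / α + C₃, by positivity, α, hα0, ?_⟩
  intro ε hε hεlt R B L D H P hR hB hL hH hP hPs hPpos hPD x x' z hx hz hx' hx'0 N hxN hzN
  have hε1 : ε < 1 := hεlt.trans_le (min_le_left _ _)
  have hε2 : ε * (6 * q) < κ := (lt_div_iff₀ (by positivity)).1 (hεlt.trans_le (min_le_right _ _))
  have hN : 0 ≤ N := (norm_nonneg _).trans hxN
  let V : ℝ → ℝ := fun t => inner ℝ (P (z t)) (z t)
  have hPz : ∀ u, ‖P u‖ ≤ K * ‖u‖ := fun u => (P.le_opNorm u).trans (by gcongr)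
  have hVle : ∀ t, V t ≤ K * ‖z t‖ ^ 2 := fun t => by
    have := (le_abs_self _).trans (abs_inner_clm_le P hP (z t) (z t))
    rw [real_inner_comm] at this
    simpa only [V, pow_two] using this
  have hVge : ∀ t, ‖z t‖ ^ 2 ≤ V t := fun t => hPpos _
  have hV' : ∀ t, HasDerivAt V
      (2 * inner ℝ (P (z t)) (ε⁻¹ • D (z t) + L (x t) + H (z t))) t := fun t => by
    have h1 := (P.hasFDerivAt.comp_hasDerivAt t (hz t)).inner ℝ (hz t)
    refine h1.congr_deriv ?_
    rw [two_mul, Function.comp_apply, hPs _ (z t), real_inner_comm]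
  have hVd : ∀ t, 2 * inner ℝ (P (z t)) (ε⁻¹ • D (z t) + L (x t) + H (z t)) ≤
      -(2 * κ / ε) * ‖z t‖ ^ 2 + 2 * q * (‖z t‖ * ‖x t‖) + 2 * q * ‖z t‖ ^ 2 := fun t => by
    rw [inner_add_right, inner_add_right, inner_smul_right]
    have h1 : ε⁻¹ * inner ℝ (P (z t)) (D (z t)) ≤ ε⁻¹ * (-κ * ‖z t‖ ^ 2) := by
      gcongr
      exact hPD _
    have h2 := (le_abs_self _).trans (abs_inner_clm_le L hL (P (z t)) (x t))
    have h3 := (le_abs_self _).trans (abs_inner_clm_le H hH (P (z t)) (z t))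
    have h4 : K * (‖P (z t)‖ * ‖x t‖) ≤ K * ((K * ‖z t‖) * ‖x t‖) := by gcongr; exact hPz _
    have h5 : K * (‖P (z t)‖ * ‖z t‖) ≤ K * ((K * ‖z t‖) * ‖z t‖) := by gcongr; exact hPz _
    have h6 : -(2 * κ / ε) * ‖z t‖ ^ 2 = 2 * (ε⁻¹ * (-κ * ‖z t‖ ^ 2)) := by
      rw [div_eq_mul_inv]; ring
    rw [h6, hq]
    nlinarith
  have hsq : ∀ {u : ℝ → X} {u' : X} {t : ℝ}, HasDerivAt u u' t →
      HasDerivAt (fun t => ‖u t‖ ^ 2) (2 * inner ℝ (u t) u') t := fun h => h.norm_sq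
  have hxd : ∀ (u : X) (v : Y), 2 * inner ℝ u (R u + B v) ≤ 3 * K * ‖u‖ ^ 2 + K * ‖v‖ ^ 2 := by
    intro u v
    have h1 := (le_abs_self _).trans (abs_inner_clm_le R hR u u)
    have h2 := (le_abs_self _).trans (abs_inner_clm_le B hB u v)
    rw [inner_add_right]
    nlinarith [mul_nonneg hK0.le (sq_nonneg (‖u‖ - ‖v‖))]
  have hV0 : V 0 ≤ K * N ^ 2 := (hVle 0).trans (by gcongr)
  -- a bound that does not depend on `ε`
  have hE : ∀ t, 0 ≤ t → t ≤ T → ‖x t‖ ^ 2 + V t ≤ C₁ * N ^ 2 := by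
    intro t ht htT
    have h1 := le_of_hasDerivAt_le_mul_add (f := fun t => ‖x t‖ ^ 2 + V t) (a := 7 * q) (b := 0)
      (T := T) (by positivity) (fun t => (hsq (hx t)).add (hV' t)) (fun t _ _ => by
        have h2 := hxd (x t) (z t)
        have h3 := hVd t
        have h4 := hVge t
        have h5 : 0 ≤ 2 * κ / ε * ‖z t‖ ^ 2 := by positivity
        nlinarith [mul_nonneg hq0.le (sq_nonneg (‖z t‖ - ‖x t‖)), mul_nonneg hq0.le (sub_nonneg.2 h4),
          mul_nonneg (sub_nonneg.2 hKq) (sq_nonneg ‖x t‖),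
          mul_nonneg (sub_nonneg.2 hKq) (sq_nonneg ‖z t‖)]) ht htT
    rw [zero_div, zero_mul, add_zero] at h1
    refine h1.trans ?_
    have h6 : ‖x 0‖ ^ 2 ≤ N ^ 2 := by gcongr
    calc _ ≤ ((1 + K) * N ^ 2) * Real.exp (7 * q * T) := by
          refine mul_le_mul ?_ (Real.exp_le_exp.2 (by gcongr)) (Real.exp_pos _).le (by positivity)
          linarith
      _ = _ := by ring
  -- Of the dissipation `2 κ / ε`, one quarter absorbs the cross term by Young's inequality and one
  -- quarter the term in `H`. The remaining half dominates `(α / ε) V`, since `V ≤ K ‖z‖²` and `α =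
  -- κ / K`.
  have hVd2 : ∀ t, 0 ≤ t → t ≤ T → 2 * inner ℝ (P (z t)) (ε⁻¹ • D (z t) + L (x t) + H (z t)) ≤
      -(α / ε) * V t + C₂ * ε * N ^ 2 := by
    intro t ht htT
    refine (hVd t).trans ?_
    have hx2 : ‖x t‖ ^ 2 ≤ C₁ * N ^ 2 := by
      have := hE t ht htT
      have := (sq_nonneg ‖z t‖).trans (hVge t)
      linarith
    set b := ‖z t‖
    set y := ‖x t‖
    have h1 : 2 * q * (b * y) ≤ κ / (2 * ε) * b ^ 2 + 2 * q ^ 2 * ε / κ * y ^ 2 := by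
      have h2 : 0 ≤ κ / (2 * ε) * (b - 2 * q * ε / κ * y) ^ 2 := by positivity
      have h3 : κ / (2 * ε) * (b - 2 * q * ε / κ * y) ^ 2 =
          κ / (2 * ε) * b ^ 2 + 2 * q ^ 2 * ε / κ * y ^ 2 - 2 * q * (b * y) := by
        field_simp; ring
      linarith
    have h4 : 2 * q ^ 2 * ε / κ * y ^ 2 ≤ C₂ * ε * N ^ 2 := by
      calc _ ≤ 2 * q ^ 2 * ε / κ * (C₁ * N ^ 2) := by gcongr
        _ = _ := by rw [hC₂]; ring
    have h5 : 2 * q * b ^ 2 ≤ κ / (2 * ε) * b ^ 2 := by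
      refine mul_le_mul_of_nonneg_right ?_ (sq_nonneg b)
      rw [le_div_iff₀ (by positivity)]
      nlinarith
    have h6 : α / ε * V t ≤ κ / ε * b ^ 2 := by
      calc _ ≤ α / ε * (K * b ^ 2) := by
            gcongr
            exact hVle t
        _ = _ := by rw [hα]; field_simp
    have h7 : -(2 * κ / ε) * b ^ 2 + (κ / (2 * ε) * b ^ 2 + κ / (2 * ε) * b ^ 2) =
        -(κ / ε * b ^ 2) := by field_simp; ring
    linarith
  intro t ht htT
  constructor
  · have hw : ∀ s, HasDerivAt (fun s => x s - x' s) (R (x s - x' s) + B (z s)) s := fun s => by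
      refine ((hx s).sub (hx' s)).congr_deriv ?_
      rw [map_sub]
      abel
    -- The added multiple of `ε V` has derivative at most `-K V` up to small terms, which cancels
    -- the forcing `K ‖z‖²`. The initial layer thus contributes only its starting value, of order
    -- `ε`.
    have h1 := le_of_hasDerivAt_le_mul_add
      (f := fun s => ‖x s - x' s‖ ^ 2 + K / α * ε * V s) (a := 3 * K)
      (b := K / α * ε * (C₂ * ε * N ^ 2)) (T := T) (by positivity)
      (fun s => (hsq (hw s)).add ((hV' s).const_mul _)) (fun s hs hsT => by
        have h2 := hxd (x s - x' s) (z s)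
        have h3 := mul_le_mul_of_nonneg_left (hVd2 s hs hsT)
          (show 0 ≤ K / α * ε by positivity)
        have h4 := hVge s
        have h5 : K / α * ε * (-(α / ε) * V s + C₂ * ε * N ^ 2) =
          -(K * V s) + K / α * ε * (C₂ * ε * N ^ 2) := by field_simp
        have h6 : 0 ≤ 3 * K * (K / α * ε * V s) := by
          have := (sq_nonneg _).trans h4
          positivity
        have h7 : K * ‖z s‖ ^ 2 ≤ K * V s := by gcongr
        rw [h5] at h3
        linarith) ht htT
    have h8 : 0 ≤ K / α * ε * V t := by
      have := (sq_nonneg _).trans (hVge t)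
      positivity
    simp only [hx'0, sub_self, norm_zero] at h1
    have h9 : Real.exp (3 * K * t) ≤ Real.exp (3 * K * T) := Real.exp_le_exp.2 (by gcongr)
    have h10 : K / α * ε * V 0 ≤ K ^ 2 / α * ε * N ^ 2 := by
      calc _ ≤ K / α * ε * (K * N ^ 2) := by gcongr
        _ = _ := by ring
    have h11 : K / α * ε * (C₂ * ε * N ^ 2) / (3 * K) ≤ C₂ / (3 * α) * ε * N ^ 2 := by
      calc _ = C₂ / (3 * α) * ε * N ^ 2 * ε := by field_simp
        _ ≤ _ := mul_le_of_le_one_right (by positivity) hε1.le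
    calc ‖x t - x' t‖ ^ 2 ≤ _ := (le_add_of_nonneg_right h8).trans h1
      _ ≤ K ^ 2 / α * ε * N ^ 2 * Real.exp (3 * K * T) +
          C₂ / (3 * α) * ε * N ^ 2 * Real.exp (3 * K * T) := by
        refine add_le_add ?_ (mul_le_mul h11 (by linarith) ?_ (by positivity))
        · refine mul_le_mul (by simpa using h10) h9 (Real.exp_pos _).le (by positivity)
        · exact sub_nonneg.2 (Real.one_le_exp (by positivity))
      _ = C₃ * ε * N ^ 2 := by rw [hC₃]; ring
      _ ≤ _ := by
        gcongr
        have : 0 ≤ K + C₂ / α := by positivity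
        linarith
  · have h1 := le_of_hasDerivAt_le_mul_add (f := V) (a := -(α / ε)) (b := C₂ * ε * N ^ 2) (T := T)
      (neg_ne_zero.2 (by positivity)) hV' hVd2 ht htT
    refine (hVge t).trans (h1.trans ?_)
    set e := Real.exp (-(α / ε) * t)
    have he : 0 < e := Real.exp_pos _
    have h2 : C₂ * ε * N ^ 2 / -(α / ε) * (e - 1) = C₂ / α * ε * N ^ 2 * (ε * (1 - e)) := by
      field_simp
      ring
    have h3 : C₂ / α * ε * N ^ 2 * (ε * (1 - e)) ≤ C₂ / α * ε * N ^ 2 * 1 := by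
      gcongr
      nlinarith
    have h4 : V 0 * e ≤ K * N ^ 2 * e := by gcongr
    have h5 : 0 ≤ (K * ε + C₂ / α * e + C₃ * (e + ε)) * N ^ 2 := by positivity
    rw [h2]
    linarith

end Gronwall

namespace SwitchedSystem

/-! ### Block operators on the product of the slow and fast spaces. -/

section Blocks

/-- The operator between Euclidean spaces given by a rectangular matrix. -/
noncomputable def blockCLM {m n : Type*} [Fintype m] [Fintype n] [DecidableEq n]
    (A : Matrix m n ℝ) : EuclideanSpace ℝ n →L[ℝ] EuclideanSpace ℝ m :=
  LinearMap.toContinuousLinearMap (Matrix.toEuclideanLin A)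

theorem ofLp_blockCLM {m n : Type*} [Fintype m] [Fintype n] [DecidableEq n] (A : Matrix m n ℝ)
    (x : EuclideanSpace ℝ n) : (blockCLM A x).ofLp = A.mulVec x.ofLp := rfl

theorem blockCLM_eq_toEuclideanCLM {n : Type*} [Fintype n] [DecidableEq n] (A : Matrix n n ℝ) :
    blockCLM A = Matrix.toEuclideanCLM (𝕜 := ℝ) A := rfl

theorem continuous_blockCLM {m n : Type*} [Fintype m] [Fintype n] [DecidableEq n] :
    Continuous (blockCLM : Matrix m n ℝ → _) :=
  let f : Matrix m n ℝ ≃ₗ[ℝ] (EuclideanSpace ℝ n →L[ℝ] EuclideanSpace ℝ m) :=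
    Matrix.toEuclideanLin.trans LinearMap.toContinuousLinearMap
  LinearMap.continuous_of_finiteDimensional f.toLinearMap

theorem blockCLM_mul_apply {l m n : Type*} [Fintype l] [Fintype m] [Fintype n] [DecidableEq m]
    [DecidableEq n] (A : Matrix l m ℝ) (B : Matrix m n ℝ) (x : EuclideanSpace ℝ n) :
    blockCLM (A * B) x = blockCLM A (blockCLM B x) := by
  refine WithLp.ofLp_injective 2 ?_
  simp only [ofLp_blockCLM, Matrix.mulVec_mulVec]

variable {m n : Type*} [Fintype m] [Fintype n]

/-- The first component of `(x, y)`. -/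
noncomputable def fstCLM (m n : Type*) [Fintype m] [Fintype n] :
    EuclideanSpace ℝ (m ⊕ n) →L[ℝ] EuclideanSpace ℝ m :=
  LinearMap.toContinuousLinearMap
    { toFun := fun v => WithLp.toLp 2 fun i => v (Sum.inl i)
      map_add' := fun _ _ => rfl
      map_smul' := fun _ _ => rfl }

/-- The second component of `(x, y)`. -/
noncomputable def sndCLM (m n : Type*) [Fintype m] [Fintype n] :
    EuclideanSpace ℝ (m ⊕ n) →L[ℝ] EuclideanSpace ℝ n :=
  LinearMap.toContinuousLinearMap
    { toFun := fun v => WithLp.toLp 2 fun i => v (Sum.inr i)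
      map_add' := fun _ _ => rfl
      map_smul' := fun _ _ => rfl }

/-- The map `x ↦ (x, -G x)`. -/
noncomputable def graphCLM (G : Matrix n m ℝ) :
    EuclideanSpace ℝ m →L[ℝ] EuclideanSpace ℝ (m ⊕ n) :=
  LinearMap.toContinuousLinearMap
    { toFun := fun x => WithLp.toLp 2 (Sum.elim x (-(G.mulVec x.ofLp)))
      map_add' := fun x y => by
        ext (i | i)
        · simp
        · simp [Matrix.mulVec_add]; ring
      map_smul' := fun c x => by
        ext (i | i)
        · simp
        · simp [Matrix.mulVec_smul] }

theorem fstCLM_graphCLM (G : Matrix n m ℝ) (x : EuclideanSpace ℝ m) :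
    fstCLM m n (graphCLM G x) = x := rfl

theorem sndCLM_graphCLM [DecidableEq m] (G : Matrix n m ℝ) (x : EuclideanSpace ℝ m) :
    sndCLM m n (graphCLM G x) = -blockCLM G x := rfl

theorem norm_sq_eq_fst_add_snd (v : EuclideanSpace ℝ (m ⊕ n)) :
    ‖v‖ ^ 2 = ‖fstCLM m n v‖ ^ 2 + ‖sndCLM m n v‖ ^ 2 := by
  simp only [EuclideanSpace.norm_sq_eq, Fintype.sum_sum_type]
  rfl

theorem norm_fstCLM_apply_le (v : EuclideanSpace ℝ (m ⊕ n)) : ‖fstCLM m n v‖ ≤ ‖v‖ := by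
  refine (sq_le_sq₀ (norm_nonneg _) (norm_nonneg v)).1 ?_
  rw [norm_sq_eq_fst_add_snd v]
  exact le_add_of_nonneg_right (sq_nonneg _)

theorem norm_sndCLM_apply_le (v : EuclideanSpace ℝ (m ⊕ n)) : ‖sndCLM m n v‖ ≤ ‖v‖ := by
  refine (sq_le_sq₀ (norm_nonneg _) (norm_nonneg v)).1 ?_
  rw [norm_sq_eq_fst_add_snd v]
  exact le_add_of_nonneg_left (sq_nonneg _)

theorem norm_le_fst_add_snd (v : EuclideanSpace ℝ (m ⊕ n)) :
    ‖v‖ ≤ ‖fstCLM m n v‖ + ‖sndCLM m n v‖ := by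
  refine (sq_le_sq₀ (norm_nonneg _) (by positivity)).1 ?_
  rw [norm_sq_eq_fst_add_snd v]
  nlinarith [norm_nonneg (fstCLM m n v), norm_nonneg (sndCLM m n v)]

theorem norm_graphCLM_le [DecidableEq m] {G : Matrix n m ℝ} {K : ℝ} (hG : ‖blockCLM G‖ ≤ K) :
    ‖graphCLM G‖ ≤ 1 + K := by
  have hK : 0 ≤ K := (norm_nonneg _).trans hG
  refine ContinuousLinearMap.opNorm_le_bound _ (by positivity) fun x => ?_
  refine (norm_le_fst_add_snd _).trans ?_
  rw [fstCLM_graphCLM, sndCLM_graphCLM, norm_neg, add_mul, one_mul]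
  gcongr
  exact ((blockCLM G).le_opNorm x).trans (by gcongr)

theorem fstCLM_toEuclideanCLM [DecidableEq m] [DecidableEq n] (A : Matrix m m ℝ)
    (B : Matrix m n ℝ) (C : Matrix n m ℝ) (D : Matrix n n ℝ) (v : EuclideanSpace ℝ (m ⊕ n)) :
    fstCLM m n (Matrix.toEuclideanCLM (𝕜 := ℝ) (Matrix.fromBlocks A B C D) v) =
      blockCLM A (fstCLM m n v) + blockCLM B (sndCLM m n v) := by
  ext i
  change ((Matrix.fromBlocks A B C D).mulVec v.ofLp) (Sum.inl i) = _
  rw [Matrix.fromBlocks_mulVec]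
  rfl

theorem sndCLM_toEuclideanCLM [DecidableEq m] [DecidableEq n] (A : Matrix m m ℝ)
    (B : Matrix m n ℝ) (C : Matrix n m ℝ) (D : Matrix n n ℝ) (v : EuclideanSpace ℝ (m ⊕ n)) :
    sndCLM m n (Matrix.toEuclideanCLM (𝕜 := ℝ) (Matrix.fromBlocks A B C D) v) =
      blockCLM C (fstCLM m n v) + blockCLM D (sndCLM m n v) := by
  ext i
  change ((Matrix.fromBlocks A B C D).mulVec v.ofLp) (Sum.inr i) = _
  rw [Matrix.fromBlocks_mulVec]
  rfl

end Blocks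

theorem _root_.Matrix.IsHurwitz.isUnit_det {ι : Type*} [Fintype ι] [DecidableEq ι]
    {D : Matrix ι ι ℝ} (hD : D.IsHurwitz) : IsUnit D.det := by
  by_contra h
  have h1 : (0 : ℂ) ∈ spectrum ℂ (D.map (algebraMap ℝ ℂ)) := by
    rw [spectrum.zero_mem_iff, Matrix.isUnit_iff_isUnit_det]
    intro h2
    refine h (isUnit_iff_ne_zero.2 fun h3 => ?_)
    have h4 := RingHom.map_det (algebraMap ℝ ℂ) D
    rw [h3, map_zero] at h4
    rw [RingHom.mapMatrix_apply] at h4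
    exact h2.ne_zero h4.symm
  exact lt_irrefl _ (hD 0 h1)

/-! ### Convergence of the flow over one piece. -/

section SingularPerturbation

variable {p q : ℕ}

/-- The matrix `D⁻¹ C`. -/
noncomputable def slowGraph (M : Matrix (Fin p ⊕ Fin q) (Fin p ⊕ Fin q) ℝ) :
    Matrix (Fin q) (Fin p) ℝ :=
  M.toBlocks₂₂⁻¹ * M.toBlocks₂₁

/-- The limit, as `ε` tends to zero, of the flow of the full system over one piece of a signal. -/
noncomputable def limitPiece (x : ℝ × Matrix (Fin p ⊕ Fin q) (Fin p ⊕ Fin q) ℝ) :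
    EuclideanSpace ℝ (Fin p ⊕ Fin q) →L[ℝ] EuclideanSpace ℝ (Fin p ⊕ Fin q) :=
  graphCLM (slowGraph x.2) ∘L pieceFlow reducedMatrix x ∘L fstCLM (Fin p) (Fin q)

/-- All inner lifts cancel because `fstCLM` is a left inverse of every `graphCLM`. Only nonempty
words qualify, since the empty product is the identity of the full space. -/
theorem wordProd_limitPiece_succ
    (a : ℕ → ℝ × Matrix (Fin p ⊕ Fin q) (Fin p ⊕ Fin q) ℝ) (n : ℕ) :
    wordProd limitPiece a (n + 1) = graphCLM (slowGraph (a n).2) ∘L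
      wordProd (pieceFlow reducedMatrix) a (n + 1) ∘L fstCLM (Fin p) (Fin q) := by
  induction n with
  | zero => rfl
  | succ n ih =>
    rw [wordProd, ih]
    rfl

theorem wordProd_reduced_eq (a : ℕ → ℝ × Matrix (Fin p ⊕ Fin q) (Fin p ⊕ Fin q) ℝ) (n : ℕ) :
    wordProd (pieceFlow reducedMatrix) a n =
      fstCLM (Fin p) (Fin q) ∘L wordProd limitPiece a n ∘L graphCLM 0 := by
  cases n with
  | zero => rfl
  | succ n => rw [wordProd_limitPiece_succ]; rfl

theorem continuous_toBlocks₁₁ : Continuous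
    fun M : Matrix (Fin p ⊕ Fin q) (Fin p ⊕ Fin q) ℝ => M.toBlocks₁₁ :=
  continuous_matrix fun _ _ => continuous_id.matrix_elem _ _

theorem continuous_toBlocks₁₂ : Continuous
    fun M : Matrix (Fin p ⊕ Fin q) (Fin p ⊕ Fin q) ℝ => M.toBlocks₁₂ :=
  continuous_matrix fun _ _ => continuous_id.matrix_elem _ _

theorem continuous_toBlocks₂₁ : Continuous
    fun M : Matrix (Fin p ⊕ Fin q) (Fin p ⊕ Fin q) ℝ => M.toBlocks₂₁ :=
  continuous_matrix fun _ _ => continuous_id.matrix_elem _ _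

theorem continuous_toBlocks₂₂ : Continuous
    fun M : Matrix (Fin p ⊕ Fin q) (Fin p ⊕ Fin q) ℝ => M.toBlocks₂₂ :=
  continuous_matrix fun _ _ => continuous_id.matrix_elem _ _

theorem continuous_fullMatrix (ε : ℝ) : Continuous (fullMatrix (p := p) (q := q) ε) := by
  have h₁ : Continuous fun M : Matrix (Fin p ⊕ Fin q) (Fin p ⊕ Fin q) ℝ => ε⁻¹ • M.toBlocks₂₁ :=
    continuous_toBlocks₂₁.const_smul ε⁻¹
  have h₂ : Continuous fun M : Matrix (Fin p ⊕ Fin q) (Fin p ⊕ Fin q) ℝ => ε⁻¹ • M.toBlocks₂₂ :=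
    continuous_toBlocks₂₂.const_smul ε⁻¹
  exact continuous_toBlocks₁₁.matrix_fromBlocks continuous_toBlocks₁₂ h₁ h₂

theorem _root_.ContinuousAt.matrix_mul {X l m n : Type*} [TopologicalSpace X] [Fintype m]
    {A : X → Matrix l m ℝ} {B : X → Matrix m n ℝ} {x : X} (hA : ContinuousAt A x)
    (hB : ContinuousAt B x) : ContinuousAt (fun x => A x * B x) x :=
  (continuous_fst.matrix_mul continuous_snd).continuousAt.comp (hA.prodMk hB)

theorem continuousAt_slowGraph {M : Matrix (Fin p ⊕ Fin q) (Fin p ⊕ Fin q) ℝ}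
    (hM : IsUnit M.toBlocks₂₂.det) : ContinuousAt slowGraph M := by
  have h1 : ContinuousAt (fun M : Matrix (Fin p ⊕ Fin q) (Fin p ⊕ Fin q) ℝ => M.toBlocks₂₂⁻¹) M :=
    ContinuousAt.comp (f := fun M : Matrix (Fin p ⊕ Fin q) (Fin p ⊕ Fin q) ℝ => M.toBlocks₂₂)
      (continuousAt_matrix_inv _ (NormedRing.inverse_continuousAt hM.unit))
      continuous_toBlocks₂₂.continuousAt
  exact ContinuousAt.matrix_mul h1 continuous_toBlocks₂₁.continuousAt

theorem reducedMatrix_eq (M : Matrix (Fin p ⊕ Fin q) (Fin p ⊕ Fin q) ℝ) :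
    reducedMatrix M = M.toBlocks₁₁ - M.toBlocks₁₂ * slowGraph M := by
  rw [reducedMatrix, slowGraph, Matrix.mul_assoc]

theorem continuousAt_reducedMatrix {M : Matrix (Fin p ⊕ Fin q) (Fin p ⊕ Fin q) ℝ}
    (hM : IsUnit M.toBlocks₂₂.det) : ContinuousAt reducedMatrix M := by
  rw [show (reducedMatrix : Matrix (Fin p ⊕ Fin q) (Fin p ⊕ Fin q) ℝ → _) = _ from
    funext reducedMatrix_eq]
  exact continuous_toBlocks₁₁.continuousAt.sub
    (ContinuousAt.matrix_mul continuous_toBlocks₁₂.continuousAt (continuousAt_slowGraph hM))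

/-- The rate `δ` depends only on `K`, `κ`, `τ` and the dimensions, so one rate serves all modes
sharing these bounds. The duration being at least `τ`, the layer term is at most `exp (-(α / ε) *
τ)`. -/
theorem exists_norm_pieceFlow_sub_limitPiece_le {K κ τ : ℝ} (hK : 1 ≤ K) (hκ : 0 < κ)
    (hτ : 0 < τ) :
    ∃ δ : ℝ → ℝ, Tendsto δ (𝓝[>] 0) (𝓝 0) ∧ ∀ᶠ ε in 𝓝[>] (0 : ℝ),
      ∀ (M : Matrix (Fin p ⊕ Fin q) (Fin p ⊕ Fin q) ℝ)
        (P : EuclideanSpace ℝ (Fin q) →L[ℝ] EuclideanSpace ℝ (Fin q)),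
      IsUnit M.toBlocks₂₂.det → ‖blockCLM (reducedMatrix M)‖ ≤ K → ‖blockCLM M.toBlocks₁₂‖ ≤ K →
      ‖blockCLM (slowGraph M * reducedMatrix M)‖ ≤ K →
      ‖blockCLM (slowGraph M * M.toBlocks₁₂)‖ ≤ K → ‖blockCLM (slowGraph M)‖ ≤ K → ‖P‖ ≤ K →
      (∀ x y, inner ℝ (P x) y = inner ℝ x (P y)) → (∀ y, ‖y‖ ^ 2 ≤ inner ℝ (P y) y) →
      (∀ y, inner ℝ (P y) (blockCLM M.toBlocks₂₂ y) ≤ -κ * ‖y‖ ^ 2) →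
      ∀ h ∈ Icc τ (2 * τ), ‖pieceFlow (fullMatrix ε) (h, M) - limitPiece (h, M)‖ ≤ δ ε := by
  obtain ⟨ε₀, hε₀, C, hC, α, hα, H⟩ := exists_tikhonov_bound (X := EuclideanSpace ℝ (Fin p))
    (Y := EuclideanSpace ℝ (Fin q)) (T := 2 * τ) hK hκ
  have hK0 : 0 ≤ K := zero_le_one.trans hK
  refine ⟨fun ε => (1 + K) * (√(C * ε * (1 + K) ^ 2)) +
    √(C * (Real.exp (-(α / ε) * τ) + ε) * (1 + K) ^ 2), ?_, ?_⟩
  · have h0 : Tendsto (fun ε : ℝ => ε) (𝓝[>] 0) (𝓝 0) := nhdsWithin_le_nhds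
    have h1 : Tendsto (fun ε : ℝ => Real.exp (-(α / ε) * τ)) (𝓝[>] 0) (𝓝 0) := by
      refine Real.tendsto_exp_atBot.comp ?_
      have h2 : Tendsto (fun ε : ℝ => (α * τ) * ε⁻¹) (𝓝[>] 0) atTop :=
        tendsto_inv_nhdsGT_zero.const_mul_atTop (by positivity)
      refine (tendsto_neg_atTop_atBot.comp h2).congr fun ε => ?_
      simp only [Function.comp, div_eq_mul_inv]
      ring
    have h3 := (((h0.const_mul C).mul_const ((1 + K) ^ 2)).sqrt.const_mul (1 + K)).add
      (((h1.add h0).const_mul C).mul_const ((1 + K) ^ 2)).sqrt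
    simpa using h3
  have hev : ∀ᶠ ε in 𝓝[>] (0 : ℝ), ε < ε₀ := nhdsWithin_le_nhds (Iio_mem_nhds hε₀)
  filter_upwards [hev, self_mem_nhdsWithin] with ε hε hε0 M P hM hR hB hL hH hG hP hPs hPp hPD h hh
  have hε0' : 0 < ε := hε0
  have hh0 : 0 ≤ h := hτ.le.trans hh.1
  set F := Matrix.toEuclideanCLM (𝕜 := ℝ) (fullMatrix ε M)
  set R := Matrix.toEuclideanCLM (𝕜 := ℝ) (reducedMatrix M)
  set G := blockCLM (slowGraph M)
  refine ContinuousLinearMap.opNorm_le_bound _ (by positivity) fun v => ?_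
  let X : ℝ → EuclideanSpace ℝ (Fin p ⊕ Fin q) := fun t => NormedSpace.exp (t • F) v
  let x : ℝ → EuclideanSpace ℝ (Fin p) := fun t => fstCLM _ _ (X t)
  let y : ℝ → EuclideanSpace ℝ (Fin q) := fun t => sndCLM _ _ (X t)
  -- The distance to the slow graph: since `D G = C`, this variable brings the system to the form of
  -- Tikhonov's estimate, with `L = G R` and `H = G B`.
  let z : ℝ → EuclideanSpace ℝ (Fin q) := fun t => y t + G (x t)
  let x' : ℝ → EuclideanSpace ℝ (Fin p) := fun t => NormedSpace.exp (t • R) (fstCLM _ _ v)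
  have hX : ∀ t, HasDerivAt X (F (X t)) t := fun t => by
    simpa using (hasDerivAt_exp_smul_const' (𝕂 := ℝ) F t).clm_apply (hasDerivAt_const t v)
  have hX0 : X 0 = v := by simp only [X, exp_zero_smul]; rfl
  have hx' : ∀ t, HasDerivAt x' (R (x' t)) t := fun t => by
    simpa using (hasDerivAt_exp_smul_const' (𝕂 := ℝ) R t).clm_apply
      (hasDerivAt_const t (fstCLM _ _ v))
  have hRM : ∀ u, R u = blockCLM M.toBlocks₁₁ u - blockCLM M.toBlocks₁₂ (G u) := fun u => by
    refine WithLp.ofLp_injective 2 ?_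
    change (reducedMatrix M).mulVec u.ofLp = M.toBlocks₁₁.mulVec u.ofLp -
      M.toBlocks₁₂.mulVec ((slowGraph M).mulVec u.ofLp)
    rw [reducedMatrix_eq, Matrix.sub_mulVec, Matrix.mulVec_mulVec]
  have hDG : ∀ u, blockCLM M.toBlocks₂₂ (G u) = blockCLM M.toBlocks₂₁ u := fun u => by
    rw [← blockCLM_mul_apply, slowGraph, Matrix.mul_nonsing_inv_cancel_left _ _ hM]
  have hx : ∀ t, HasDerivAt x (R (x t) + blockCLM M.toBlocks₁₂ (z t)) t := fun t => by
    refine ((fstCLM _ _).hasFDerivAt.comp_hasDerivAt t (hX t)).congr_deriv ?_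
    rw [hRM, map_add]
    simp only [F, fullMatrix, fstCLM_toEuclideanCLM]
    change blockCLM M.toBlocks₁₁ (x t) + blockCLM M.toBlocks₁₂ (y t) = _
    abel
  have hy : ∀ t, HasDerivAt y (ε⁻¹ • blockCLM M.toBlocks₂₂ (z t)) t := fun t => by
    refine ((sndCLM _ _).hasFDerivAt.comp_hasDerivAt t (hX t)).congr_deriv ?_
    rw [map_add, hDG]
    simp only [F, fullMatrix, sndCLM_toEuclideanCLM]
    refine WithLp.ofLp_injective 2 ?_
    change (ε⁻¹ • M.toBlocks₂₁).mulVec (x t).ofLp + (ε⁻¹ • M.toBlocks₂₂).mulVec (y t).ofLp =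
      ε⁻¹ • (M.toBlocks₂₂.mulVec (y t).ofLp + M.toBlocks₂₁.mulVec (x t).ofLp)
    rw [Matrix.smul_mulVec, Matrix.smul_mulVec, smul_add, add_comm]
  have hz : ∀ t, HasDerivAt z (ε⁻¹ • blockCLM M.toBlocks₂₂ (z t) +
      blockCLM (slowGraph M * reducedMatrix M) (x t) +
      blockCLM (slowGraph M * M.toBlocks₁₂) (z t)) t := fun t => by
    refine ((hy t).add (G.hasFDerivAt.comp_hasDerivAt t (hx t))).congr_deriv ?_
    rw [blockCLM_mul_apply, blockCLM_mul_apply, add_assoc]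
    exact congrArg (ε⁻¹ • blockCLM M.toBlocks₂₂ (z t) + ·) (map_add G _ _)
  have hx0 : ‖x 0‖ ≤ (1 + K) * ‖v‖ := by
    have : ‖x 0‖ ≤ ‖v‖ := by simpa only [x, hX0] using norm_fstCLM_apply_le v
    nlinarith [norm_nonneg v]
  have hz0 : ‖z 0‖ ≤ (1 + K) * ‖v‖ := by
    have h1 : ‖y 0‖ ≤ ‖v‖ := by simpa only [y, hX0] using norm_sndCLM_apply_le v
    have h2 : ‖x 0‖ ≤ ‖v‖ := by simpa only [x, hX0] using norm_fstCLM_apply_le v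
    calc ‖z 0‖ ≤ ‖y 0‖ + ‖G (x 0)‖ := norm_add_le _ _
      _ ≤ ‖v‖ + K * ‖v‖ := add_le_add h1 ((G.le_opNorm _).trans (by gcongr))
      _ = _ := by ring
  have hx'0 : x' 0 = x 0 := by simp only [x', x, hX0, exp_zero_smul]; rfl
  obtain ⟨h1, h2⟩ := H ε hε0' hε R _ _ _ _ P hR hB hL hH hP hPs hPp hPD x x' z hx hz hx' hx'0 _
    hx0 hz0 h hh0 hh.2
  have h3 : ‖x h - x' h‖ ≤ √(C * ε * (1 + K) ^ 2) * ‖v‖ := by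
    refine (sq_le_sq₀ (norm_nonneg _) (by positivity)).1 (h1.trans_eq ?_)
    rw [mul_pow, mul_pow, Real.sq_sqrt (by positivity)]
    ring
  have h4 : ‖z h‖ ≤ √(C * (Real.exp (-(α / ε) * τ) + ε) * (1 + K) ^ 2) * ‖v‖ := by
    refine (sq_le_sq₀ (norm_nonneg _) (by positivity)).1 (h2.trans ?_)
    have h5 : Real.exp (-(α / ε) * h) ≤ Real.exp (-(α / ε) * τ) := by
      refine Real.exp_le_exp.2 ?_
      rw [neg_mul, neg_mul, neg_le_neg_iff]
      exact mul_le_mul_of_nonneg_left hh.1 (by positivity)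
    rw [mul_pow, mul_pow, Real.sq_sqrt (by positivity), ← mul_assoc]
    gcongr
  have h5 : fstCLM _ _ ((pieceFlow (fullMatrix ε) (h, M) - limitPiece (h, M)) v) = x h - x' h := by
    rw [sub_apply, map_sub]
    rfl
  have h6 : sndCLM _ _ ((pieceFlow (fullMatrix ε) (h, M) - limitPiece (h, M)) v) =
      z h - G (x h - x' h) := by
    rw [sub_apply, map_sub, map_sub]
    change y h - -(G (x' h)) = y h + G (x h) - (G (x h) - G (x' h))
    abel
  refine (norm_le_fst_add_snd _).trans ?_
  rw [h5, h6]
  have h7 : ‖z h - G (x h - x' h)‖ ≤ ‖z h‖ + K * ‖x h - x' h‖ :=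
    (norm_sub_le _ _).trans (add_le_add le_rfl ((G.le_opNorm _).trans (by gcongr)))
  nlinarith [norm_nonneg (x h - x' h)]

end SingularPerturbation

/-! ### Uniform convergence of the letters and convergence of the exponents. -/

section Convergence

variable {p q : ℕ}

/-- By compactness it is enough to argue near one mode `M₀`. The Lyapunov form `P` of its block `D`
still works for nearby modes with half the decay, so no continuous choice of `P` is needed. -/
theorem tendstoUniformlyOn_pieceFlow (hq : 0 < q) {τ : ℝ} (hτ : 0 < τ)
    {𝓜 : Set (Matrix (Fin p ⊕ Fin q) (Fin p ⊕ Fin q) ℝ)} (h𝓜 : IsCompact 𝓜)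
    (hD : ∀ M ∈ 𝓜, M.toBlocks₂₂.IsHurwitz) :
    TendstoUniformlyOn (fun ε => pieceFlow (fullMatrix ε)) limitPiece (𝓝[>] 0)
      (letters 𝓜 τ) := by
  have : Nonempty (Fin q) := ⟨⟨0, hq⟩⟩
  have hcomp : IsCompact (letters 𝓜 τ) := isCompact_Icc.prod h𝓜
  rw [← tendstoLocallyUniformlyOn_iff_tendstoUniformlyOn_of_compact hcomp,
    Metric.tendstoLocallyUniformlyOn_iff]
  rintro η hη ⟨h₀, M₀⟩ ⟨-, hM₀⟩
  obtain ⟨P, hPs, hPp, κ, hκ, hPD⟩ := (hD M₀ hM₀).exists_lyapunov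
  have hu := (hD M₀ hM₀).isUnit_det
  have hnb : ∀ {m n : Type} [Fintype m] [Fintype n] [DecidableEq n]
      {f : Matrix (Fin p ⊕ Fin q) (Fin p ⊕ Fin q) ℝ → Matrix m n ℝ}, ContinuousAt f M₀ →
      ∀ᶠ M in 𝓝 M₀, ‖blockCLM (f M)‖ < ‖blockCLM (f M₀)‖ + 1 := fun hf =>
    ((continuous_blockCLM.continuousAt.comp hf).norm).eventually_lt_const (lt_add_one _)
  have c₁₂ := (continuous_toBlocks₁₂ (p := p) (q := q)).continuousAt (x := M₀)
  have cR := continuousAt_reducedMatrix hu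
  have cG := continuousAt_slowGraph hu
  have cGR := ContinuousAt.matrix_mul cG cR
  have cGB := ContinuousAt.matrix_mul cG c₁₂
  set K := ‖blockCLM (reducedMatrix M₀)‖ + ‖blockCLM M₀.toBlocks₁₂‖ +
    ‖blockCLM (slowGraph M₀ * reducedMatrix M₀)‖ + ‖blockCLM (slowGraph M₀ * M₀.toBlocks₁₂)‖ +
    ‖blockCLM (slowGraph M₀)‖ + ‖P‖ + 1 with hK
  have n1 := norm_nonneg (blockCLM (reducedMatrix M₀))
  have n2 := norm_nonneg (blockCLM M₀.toBlocks₁₂)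
  have n3 := norm_nonneg (blockCLM (slowGraph M₀ * reducedMatrix M₀))
  have n4 := norm_nonneg (blockCLM (slowGraph M₀ * M₀.toBlocks₁₂))
  have n5 := norm_nonneg (blockCLM (slowGraph M₀))
  have n6 := norm_nonneg P
  obtain ⟨δ, hδ, hev⟩ := exists_norm_pieceFlow_sub_limitPiece_le (p := p) (q := q) (K := K)
    (κ := κ / 2) (τ := τ) (by linarith) (by positivity) hτ
  have hDn : ∀ᶠ M in 𝓝 M₀,
      ‖blockCLM (Matrix.toBlocks₂₂ M) - blockCLM M₀.toBlocks₂₂‖ < κ / 2 / (‖P‖ + 1) := by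
    have hc : ContinuousAt (fun M : Matrix (Fin p ⊕ Fin q) (Fin p ⊕ Fin q) ℝ =>
        ‖blockCLM M.toBlocks₂₂ - blockCLM M₀.toBlocks₂₂‖) M₀ :=
      (((continuous_blockCLM.comp continuous_toBlocks₂₂).sub continuous_const).norm).continuousAt
    refine hc.eventually_lt_const ?_
    simp only [sub_self, norm_zero]
    positivity
  let t : Set (Matrix (Fin p ⊕ Fin q) (Fin p ⊕ Fin q) ℝ) := {M | M ∈ 𝓜 →
    IsUnit M.toBlocks₂₂.det ∧ ‖blockCLM (reducedMatrix M)‖ ≤ K ∧ ‖blockCLM M.toBlocks₁₂‖ ≤ K ∧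
      ‖blockCLM (slowGraph M * reducedMatrix M)‖ ≤ K ∧
      ‖blockCLM (slowGraph M * M.toBlocks₁₂)‖ ≤ K ∧ ‖blockCLM (slowGraph M)‖ ≤ K ∧
      ∀ y, inner ℝ (P y) (blockCLM M.toBlocks₂₂ y) ≤ -(κ / 2) * ‖y‖ ^ 2}
  have ht : t ∈ 𝓝 M₀ := by
    filter_upwards [hnb cR, hnb c₁₂, hnb cGR, hnb cGB, hnb cG, hDn] with M h1 h2 h3 h4 h5 h6 hM
    refine ⟨(hD M hM).isUnit_det, by linarith, by linarith, by linarith, by linarith, by linarith,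
      fun y => ?_⟩
    have h7 := hPD y
    rw [← blockCLM_eq_toEuclideanCLM] at h7
    have h8 : inner ℝ (P y) (blockCLM (Matrix.toBlocks₂₂ M) y) =
        inner ℝ (P y) (blockCLM M₀.toBlocks₂₂ y) +
          inner ℝ (P y) ((blockCLM (Matrix.toBlocks₂₂ M) - blockCLM M₀.toBlocks₂₂) y) := by
      rw [← inner_add_right, sub_apply, add_sub_cancel]
    have h9 := (le_abs_self _).trans
      (abs_inner_clm_le (blockCLM (Matrix.toBlocks₂₂ M) - blockCLM M₀.toBlocks₂₂) h6.le (P y) y)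
    have h10 : κ / 2 / (‖P‖ + 1) * (‖P y‖ * ‖y‖) ≤ κ / 2 * ‖y‖ ^ 2 := by
      calc _ ≤ κ / 2 / (‖P‖ + 1) * (((‖P‖ + 1) * ‖y‖) * ‖y‖) := by
            gcongr
            exact (P.le_opNorm y).trans (by gcongr; linarith)
        _ = _ := by field_simp
    rw [h8]
    linarith
  refine ⟨letters 𝓜 τ ∩ Prod.snd ⁻¹' t, inter_mem self_mem_nhdsWithin
    (mem_nhdsWithin_of_mem_nhds (continuous_snd.continuousAt ht)), ?_⟩
  filter_upwards [hev, hδ.eventually_lt_const hη] with ε h1 h2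
  rintro ⟨h, M⟩ ⟨hx, hMt⟩
  obtain ⟨a1, a2, a3, a4, a5, a6, a7⟩ := hMt hx.2
  rw [dist_comm, dist_eq_norm]
  exact (h1 M P a1 a2 a3 a4 a5 a6 (by linarith) hPs hPp a7 h hx.1).trans_lt h2

/-- Durations vary from letter to letter, so a rate per unit time is not a rate per letter. This
weighting turns growth at rate `μ` in time into boundedness of products. -/
theorem wordProd_exp_smul {α E : Type*} [NormedAddCommGroup E] [NormedSpace ℝ E]
    (g : ℝ × α → E →L[ℝ] E) (μ : ℝ) (a : ℕ → ℝ × α) (n : ℕ) :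
    wordProd (fun x => Real.exp (-(μ * x.1)) • g x) a n =
      Real.exp (-(μ * startTime a n)) • wordProd g a n := by
  induction n with
  | zero => simp [wordProd]
  | succ n ih =>
    rw [wordProd, ih, wordProd, startTime_succ, smul_mul_smul_comm, ← Real.exp_add]
    congr 2
    ring

theorem norm_wordProd_exp_smul_le_iff {α E : Type*} [NormedAddCommGroup E] [NormedSpace ℝ E]
    (g : ℝ × α → E →L[ℝ] E) (μ : ℝ) (a : ℕ → ℝ × α) (n : ℕ) (C : ℝ) :
    ‖wordProd (fun x => Real.exp (-(μ * x.1)) • g x) a n‖ ≤ C ↔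
      ‖wordProd g a n‖ ≤ C * Real.exp (μ * startTime a n) := by
  rw [wordProd_exp_smul, norm_smul, Real.norm_eq_abs, Real.abs_exp, Real.exp_neg, inv_mul_eq_div,
    div_le_iff₀ (Real.exp_pos _)]

theorem tendstoUniformlyOn_exp_smul {α κ E : Type*} [NormedAddCommGroup E] [NormedSpace ℝ E]
    {l : Filter κ} {g : κ → ℝ × α → E →L[ℝ] E} {g₀ : ℝ × α → E →L[ℝ] E} {𝓜 : Set α} {τ : ℝ}
    (hτ : 0 < τ) (h : TendstoUniformlyOn g g₀ l (letters 𝓜 τ)) (μ : ℝ) :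
    TendstoUniformlyOn (fun ε x => Real.exp (-(μ * x.1)) • g ε x)
      (fun x => Real.exp (-(μ * x.1)) • g₀ x) l (letters 𝓜 τ) := by
  rw [Metric.tendstoUniformlyOn_iff] at h ⊢
  intro η hη
  filter_upwards [h (η / Real.exp (|μ| * (2 * τ))) (by positivity)] with ε hε x hx
  have h1 := hε x hx
  rw [lt_div_iff₀ (Real.exp_pos _)] at h1
  rw [dist_eq_norm] at h1 ⊢
  rw [← smul_sub, norm_smul, Real.norm_eq_abs, Real.abs_exp, mul_comm]
  refine lt_of_le_of_lt (mul_le_mul_of_nonneg_left (Real.exp_le_exp.2 ?_) (norm_nonneg _)) h1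
  have h2 : 0 ≤ x.1 := hτ.le.trans hx.1.1
  calc -(μ * x.1) ≤ |μ| * x.1 := by
        rw [← neg_mul]
        exact mul_le_mul_of_nonneg_right (neg_le_abs μ) h2
    _ ≤ |μ| * (2 * τ) := mul_le_mul_of_nonneg_left hx.1.2 (abs_nonneg μ)

variable {τ : ℝ} {𝓜 : Set (Matrix (Fin p ⊕ Fin q) (Fin p ⊕ Fin q) ℝ)}

theorem exists_bound_fullMatrix (h𝓜 : IsCompact 𝓜) (ε : ℝ) : ∃ K, 0 ≤ K ∧
    ∀ M ∈ 𝓜, ‖Matrix.toEuclideanCLM (𝕜 := ℝ) (fullMatrix ε M)‖ ≤ K := by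
  obtain ⟨K, hK⟩ := h𝓜.exists_bound_of_continuousOn
    (Matrix.continuous_toEuclideanCLM.comp (continuous_fullMatrix (p := p) (q := q) ε)).continuousOn
  exact ⟨|K|, abs_nonneg K, fun M hM => (hK M hM).trans (le_abs_self K)⟩

theorem exists_bound_reducedMatrix (h𝓜 : IsCompact 𝓜) (hD : ∀ M ∈ 𝓜, M.toBlocks₂₂.IsHurwitz) :
    ∃ K, 0 ≤ K ∧ ∀ M ∈ 𝓜, ‖Matrix.toEuclideanCLM (𝕜 := ℝ) (reducedMatrix M)‖ ≤ K := by
  obtain ⟨K, hK⟩ := h𝓜.exists_bound_of_continuousOn (f := fun M =>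
    Matrix.toEuclideanCLM (𝕜 := ℝ) (reducedMatrix M)) fun M hM =>
      (Matrix.continuous_toEuclideanCLM.continuousAt.comp
        (continuousAt_reducedMatrix (hD M hM).isUnit_det)).continuousWithinAt
  exact ⟨|K|, abs_nonneg K, fun M hM => (hK M hM).trans (le_abs_self K)⟩

theorem exists_bound_graphCLM (h𝓜 : IsCompact 𝓜) (hD : ∀ M ∈ 𝓜, M.toBlocks₂₂.IsHurwitz) :
    ∃ K, 0 ≤ K ∧ ∀ M ∈ 𝓜, ‖graphCLM (slowGraph M)‖ ≤ K := by
  obtain ⟨K, hK⟩ := h𝓜.exists_bound_of_continuousOn (f := fun M =>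
    blockCLM (slowGraph M)) fun M hM => (continuous_blockCLM.continuousAt.comp
      (continuousAt_slowGraph (hD M hM).isUnit_det)).continuousWithinAt
  exact ⟨1 + |K|, by positivity, fun M hM =>
    norm_graphCLM_le ((hK M hM).trans (le_abs_self K))⟩

theorem norm_fstCLM_le {m n : Type*} [Fintype m] [Fintype n] : ‖fstCLM m n‖ ≤ 1 :=
  ContinuousLinearMap.opNorm_le_bound _ zero_le_one fun v => by
    simpa using norm_fstCLM_apply_le v

theorem exists_bound_limitPiece (hτ : 0 < τ) (h𝓜 : IsCompact 𝓜)
    (hD : ∀ M ∈ 𝓜, M.toBlocks₂₂.IsHurwitz) (μ : ℝ) :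
    ∃ b, ∀ x ∈ letters 𝓜 τ, ‖Real.exp (-(μ * x.1)) • limitPiece x‖ ≤ b := by
  obtain ⟨K, hK0, hK⟩ := exists_bound_reducedMatrix h𝓜 hD
  obtain ⟨K', hK'0, hK'⟩ := exists_bound_graphCLM h𝓜 hD
  refine ⟨Real.exp (|μ| * (2 * τ)) * (K' * Real.exp (K * (2 * τ))), fun x hx => ?_⟩
  rw [norm_smul, Real.norm_eq_abs, Real.abs_exp]
  have h2 : 0 ≤ x.1 := hτ.le.trans hx.1.1
  refine mul_le_mul (Real.exp_le_exp.2 ?_) ?_ (norm_nonneg _) (Real.exp_pos _).le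
  · calc -(μ * x.1) ≤ |μ| * x.1 := by
          rw [← neg_mul]
          exact mul_le_mul_of_nonneg_right (neg_le_abs μ) h2
      _ ≤ |μ| * (2 * τ) := mul_le_mul_of_nonneg_left hx.1.2 (abs_nonneg μ)
  · refine (ContinuousLinearMap.opNorm_comp_le _ _).trans
      (mul_le_mul (hK' _ hx.2) ?_ (norm_nonneg _) hK'0)
    refine (ContinuousLinearMap.opNorm_comp_le _ _).trans ?_
    calc _ ≤ Real.exp (K * (2 * τ)) * 1 := mul_le_mul (norm_pieceFlow_le hτ hK0 hK hx)
          norm_fstCLM_le (norm_nonneg _) (Real.exp_pos _).le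
      _ = _ := mul_one _

theorem eventually_le_lyapunovExponent (hp : 0 < p) (hq : 0 < q) (hτ : 0 < τ)
    (h𝓜 : IsCompact 𝓜) (hD : ∀ M ∈ 𝓜, M.toBlocks₂₂.IsHurwitz) {μ : ℝ}
    (hμ : (μ : EReal) < lyapunovExponent 𝓜 τ reducedMatrix) :
    ∀ᶠ ε : ℝ in 𝓝[>] 0, (μ : EReal) ≤ lyapunovExponent 𝓜 τ (fullMatrix ε) := by
  have : Nonempty (Fin p ⊕ Fin q) := ⟨Sum.inl ⟨0, hp⟩⟩
  obtain ⟨ν, h1, h2⟩ := EReal.lt_iff_exists_real_btwn.1 hμ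
  have hμν : μ < ν := by exact_mod_cast h1
  by_contra hcon
  have hfreq : ∃ᶠ ε : ℝ in 𝓝[>] 0, ∃ C, ∀ a : ℕ → ℝ × _, (∀ i, a i ∈ letters 𝓜 τ) → ∀ n,
      ‖wordProd (fun x => Real.exp (-(μ * x.1)) • pieceFlow (fullMatrix ε) x) a n‖ ≤ C := by
    refine (not_eventually.1 hcon).mono fun ε hε => ?_
    obtain ⟨K, hK0, hK⟩ := exists_bound_fullMatrix h𝓜 ε
    obtain ⟨C, -, hC⟩ :=
      exists_norm_wordProd_le_of_lyapunovExponent_lt hτ hK0 hK (not_le.1 hε)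
    exact ⟨C, fun a ha n => (norm_wordProd_exp_smul_le_iff _ _ _ _ _).2 (hC a ha n)⟩
  obtain ⟨b, hb⟩ := exists_bound_limitPiece hτ h𝓜 hD μ
  obtain ⟨B, hB⟩ := exists_norm_wordProd_le_mul_exp
    (tendstoUniformlyOn_exp_smul hτ (tendstoUniformlyOn_pieceFlow hq hτ h𝓜 hD) μ) hb hfreq
    -- Each letter lasts at least `τ`, so growth `η` per letter is growth at most `ν - μ` per unit
    -- time.
    (η := (ν - μ) * τ) (mul_pos (sub_pos.2 hμν) hτ)
  obtain ⟨K, hK0, hK⟩ := exists_bound_reducedMatrix h𝓜 hD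
  obtain ⟨C, -, hC⟩ := exists_norm_flow_le_of_norm_wordProd_le (F := reducedMatrix) (𝓜 := 𝓜)
    (C := |B| * ‖graphCLM (0 : Matrix (Fin q) (Fin p) ℝ)‖) (ν := ν) hτ hK0 hK fun a ha n => by
      have h3 := (norm_wordProd_exp_smul_le_iff _ _ _ _ _).1 (hB a ha n)
      have h4 : ‖wordProd limitPiece a n‖ ≤ |B| * Real.exp (ν * startTime a n) := by
        refine h3.trans ?_
        rw [mul_assoc, ← Real.exp_add]
        refine mul_le_mul (le_abs_self B) (Real.exp_le_exp.2 ?_) (Real.exp_pos _).le (abs_nonneg B)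
        have := mul_le_mul_of_nonneg_left (mul_le_startTime ha n) (sub_nonneg.2 hμν.le)
        linarith
      rw [wordProd_reduced_eq]
      calc _ ≤ 1 * (‖wordProd limitPiece a n‖ * ‖graphCLM (0 : Matrix (Fin q) (Fin p) ℝ)‖) :=
            (ContinuousLinearMap.opNorm_comp_le _ _).trans (mul_le_mul norm_fstCLM_le
              (ContinuousLinearMap.opNorm_comp_le _ _) (norm_nonneg _) zero_le_one)
        _ ≤ 1 * ((|B| * Real.exp (ν * startTime a n)) *
            ‖graphCLM (0 : Matrix (Fin q) (Fin p) ℝ)‖) := by gcongr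
        _ = _ := by ring
  exact (lyapunovExponent_le_of_norm_flow_le hC).not_gt h2

theorem eventually_lyapunovExponent_le (hp : 0 < p) (hq : 0 < q) (hτ : 0 < τ)
    (h𝓜 : IsCompact 𝓜) (hD : ∀ M ∈ 𝓜, M.toBlocks₂₂.IsHurwitz) {μ : ℝ}
    (hμ : lyapunovExponent 𝓜 τ reducedMatrix < μ) :
    ∀ᶠ ε : ℝ in 𝓝[>] 0, lyapunovExponent 𝓜 τ (fullMatrix ε) ≤ μ := by
  have : Nonempty (Fin p ⊕ Fin q) := ⟨Sum.inl ⟨0, hp⟩⟩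
  obtain ⟨ν, h1, h2⟩ := EReal.lt_iff_exists_real_btwn.1 hμ
  have hνμ : ν < μ := by exact_mod_cast h2
  obtain ⟨K, hK0, hK⟩ := exists_bound_reducedMatrix h𝓜 hD
  obtain ⟨K', hK'0, hK'⟩ := exists_bound_graphCLM h𝓜 hD
  obtain ⟨C, hC0, hC⟩ := exists_norm_wordProd_le_of_lyapunovExponent_lt hτ hK0 hK h1
  obtain ⟨b, hb⟩ := exists_bound_limitPiece hτ h𝓜 hD μ
  have hlim : ∀ a : ℕ → ℝ × _, (∀ i, a i ∈ letters 𝓜 τ) → ∀ n,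
      ‖wordProd limitPiece a n‖ ≤ (1 + K' * C) * Real.exp (ν * startTime a n) := by
    intro a ha n
    have hKC : 0 ≤ K' * C := mul_nonneg hK'0 hC0
    cases n with
    | zero => simpa [wordProd] using hKC
    | succ n =>
      rw [wordProd_limitPiece_succ]
      calc _ ≤ K' * ((C * Real.exp (ν * startTime a (n + 1))) * 1) :=
            (ContinuousLinearMap.opNorm_comp_le _ _).trans (mul_le_mul (hK' _ (ha n).2)
              ((ContinuousLinearMap.opNorm_comp_le _ _).trans (mul_le_mul (hC a ha _)
                norm_fstCLM_le (norm_nonneg _) (by positivity))) (norm_nonneg _) hK'0)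
        _ ≤ _ := by nlinarith [Real.exp_pos (ν * startTime a (n + 1))]
  -- The gap `μ - ν` over a duration of at least `τ` makes the weighted limit products decay
  -- geometrically in the number of letters.
  have hθ : Real.exp (-((μ - ν) * τ)) < 1 :=
    Real.exp_lt_one_iff.2 (neg_neg_of_pos (mul_pos (sub_pos.2 hνμ) hτ))
  have hev := eventually_exists_norm_wordProd_le
    (tendstoUniformlyOn_exp_smul hτ (tendstoUniformlyOn_pieceFlow hq hτ h𝓜 hD) μ) hb
    (C := 1 + K' * C) (Real.exp_pos _).le hθ fun a ha n => by
      rw [norm_wordProd_exp_smul_le_iff]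
      refine (hlim a ha n).trans ?_
      rw [mul_assoc, ← Real.exp_nat_mul, ← Real.exp_add]
      refine mul_le_mul_of_nonneg_left (Real.exp_le_exp.2 ?_) (by positivity)
      have := mul_le_mul_of_nonneg_left (mul_le_startTime ha n) (sub_nonneg.2 hνμ.le)
      linarith
  filter_upwards [hev] with ε hε
  obtain ⟨C', hC'⟩ := hε
  obtain ⟨Kε, hKε0, hKε⟩ := exists_bound_fullMatrix h𝓜 ε
  obtain ⟨C'', -, H⟩ := exists_norm_flow_le_of_norm_wordProd_le hτ hKε0 hKε fun a ha n =>
    (norm_wordProd_exp_smul_le_iff _ _ _ _ _).1 (hC' a ha n)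
  exact lyapunovExponent_le_of_norm_flow_le H

theorem tendsto_lyapunovExponent (hp : 0 < p) (hq : 0 < q) (hτ : 0 < τ) (h𝓜 : IsCompact 𝓜)
    (hD : ∀ M ∈ 𝓜, M.toBlocks₂₂.IsHurwitz) :
    Tendsto (fun ε : ℝ => lyapunovExponent 𝓜 τ (fullMatrix ε)) (𝓝[>] 0)
      (𝓝 (lyapunovExponent 𝓜 τ reducedMatrix)) := by
  -- Working with the order of `EReal` also covers the exponent `-∞`, which occurs when `𝓜` is
  -- empty.
  refine tendsto_order.2 ⟨fun c hc => ?_, fun c hc => ?_⟩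
  · obtain ⟨μ, h1, h2⟩ := EReal.lt_iff_exists_real_btwn.1 hc
    filter_upwards [eventually_le_lyapunovExponent hp hq hτ h𝓜 hD h2] with ε hε
    exact h1.trans_le hε
  · obtain ⟨μ, h1, h2⟩ := EReal.lt_iff_exists_real_btwn.1 hc
    filter_upwards [eventually_lyapunovExponent_le hp hq hτ h𝓜 hD h1] with ε hε
    exact hε.trans_lt h2

end Convergence

end SwitchedSystem

theorem mainTheorem4 {p q : ℕ} (hp : 0 < p) (hq : 0 < q) {τ : ℝ} (hτ : 0 < τ)
    (𝓜 : Set (Matrix (Fin p ⊕ Fin q) (Fin p ⊕ Fin q) ℝ)) (h𝓜 : IsCompact 𝓜)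
    (hD : ∀ M ∈ 𝓜, M.toBlocks₂₂.IsHurwitz) :
    Tendsto (fun ε : ℝ => SwitchedSystem.lyapunovExponent 𝓜 τ (SwitchedSystem.fullMatrix ε))
        (𝓝[>] 0) (𝓝 (SwitchedSystem.lyapunovExponent 𝓜 τ SwitchedSystem.reducedMatrix)) ∧
      (SwitchedSystem.IsES 𝓜 τ SwitchedSystem.reducedMatrix →
        ∀ᶠ ε : ℝ in 𝓝[>] 0, SwitchedSystem.IsES 𝓜 τ (SwitchedSystem.fullMatrix ε)) ∧
      (SwitchedSystem.IsEU 𝓜 τ SwitchedSystem.reducedMatrix →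
        ∀ᶠ ε : ℝ in 𝓝[>] 0, SwitchedSystem.IsEU 𝓜 τ (SwitchedSystem.fullMatrix ε)) := by
  have hlim := SwitchedSystem.tendsto_lyapunovExponent hp hq hτ h𝓜 hD
  have : Nonempty (Fin p ⊕ Fin q) := ⟨Sum.inl ⟨0, hp⟩⟩
  refine ⟨hlim, fun h => ?_, fun h => ?_⟩
  · filter_upwards [hlim.eventually_lt_const h.lyapunovExponent_neg] with ε hε
    obtain ⟨K, hK0, hK⟩ := SwitchedSystem.exists_bound_fullMatrix h𝓜 ε
    exact SwitchedSystem.isES_of_lyapunovExponent_neg hτ hK0 hK hε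
  · filter_upwards [hlim.eventually_const_lt h.lyapunovExponent_pos] with ε hε
    exact SwitchedSystem.isEU_of_lyapunovExponent_pos hτ h𝓜
      (SwitchedSystem.continuous_fullMatrix ε) hε
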